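/- **Setting.** Decompose $\mathbb R^m=\mathbb R^{m_1}\times\dots\times\mathbb R^{m_d}$ and write $x=(x_1,\dots,x_d)$. Let $A=[A_1,\dots,A_d]\in\mathbb R^{q\times m}$, $b\in\mathbb R^q$, $h(x)=\frac12\|Ax-b\|^2$ and $\mathcal X=\arg\min_{\mathbb R^m}h$. For each block $i$ let $r_i:\mathbb R^{m_i}\to(-\infty,\infty]$ be proper, convex and lower semicontinuous, and let $\phi_i:\mathbb R^{m_i}\to\mathbb R$ be differentiable and satisfy, for a symmetric positive definite matrix $\Lambda_i$ and all $u,t\in\mathbb R^{m_i}$, $$0\le \phi_i(u+t)-\phi_i(u)-\langle\nabla\phi_i(u),t\rangle\le\tfrac12\langle\Lambda_i t,t\rangle .$$ Put $\Phi(x)=\sum_i\phi_i(x_i)$, $R(x)=\sum_i r_i(x_i)$, $\Psi=\Phi+R$, and let $\mathcal X^*$ be the set of minimisers of $\Psi$ over $\mathcal X$. A saddle point is a pair $(x^*,y^*)\in\mathbb R^m\times\mathbb R^m$ with $A^\top A y^*\in\partial\Psi(x^*)$ and $A^\top A x^*=A^\top b$. **Sampling.** Let $\mathcal I$ be a random subset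 of $\{1,\dots,d\}$ that is proper, i.e. $\pi_i:=\mathbb P(i\in\mathcal I)>0$ for all $i$, and let $(\iota_k)_{k\ge0}$ be independent copies of $\mathcal I$. Let $P=\mathrm{blkdiag}[\pi_1^{-1}\mathrm{Id},\dots,\pi_d^{-1}\mathrm{Id}]$, let $E$ be the block diagonal matrix whose $i$-th block is $\mathrm{Id}$ if $i\in\mathcal I$ and $0$ otherwise, and let $\Xi=\mathbb E[EPA^\top APE]$. **Algorithm.** Let $B_1,\dots,B_d$ be symmetric positive definite matrices ($B_i$ of size $m_i\times m_i$), $B=\mathrm{blkdiag}[B_1,\dots,B_d]$, $\Lambda=\mathrm{blkdiag}[\Lambda_1,\dots,\Lambda_d]$. Take constant step parameters $\sigma_k\equiv\sigma$ and $\tau_k\equiv1$, where $$0<\sigma\le\min_i\pi_i,\qquad PB\succeq\sigma\Xi+\Lambda .$$ Let $S_k=1+k\sigma$ and $\theta_k=\sigma/S_k$. Starting from $x^0=w^0\in\mathrm{dom}\,R$, define for $k=0,1,2,\dots$: $z^k=(1-\theta_k)w^k+\theta_kx^k$; for $i\in\iota_k$, $$x_i^{k+1}=\arg\min_{u\in\mathbb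 R^{m_i}}\Big\{r_i(u)+\big\langle\nabla\phi_i(x_i^k)+S_k\nabla_ih(z^k),\,u-x_i^k\big\rangle+\tfrac1{2\pi_i}\big\langle B_i(u-x_i^k),u-x_i^k\big\rangle\Big\},$$ and $x_i^{k+1}=x_i^k$ for $i\notin\iota_k$; and $w^{k+1}=z^k+\theta_kP(x^{k+1}-x^k)$. **Theorem.** Assume that a saddle point exists and that $\mathcal X^*$ is nonempty. Then, for every $x^*\in\mathcal X^*$: (i) almost surely, $h(w^k)-h(x^*)=O(1/k^2)$; (ii) there is a random variable $\bar x$ with values in $\mathcal X^*$ such that, almost surely, both $x^k\to\bar x$ and $w^k\to\bar x$; (iii) $\Psi(x^*)$ and, almost surely, all the values $\Psi(w^k)$ are finite, and almost surely $|\Psi(w^k)-\Psi(x^*)|=O(1/k)$. The constants in the $O$-terms may depend on the realisation. -/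

import Mathlib

open MeasureTheory ProbabilityTheory Filter Topology Asymptotics

noncomputable section

namespace RBCD

/-- The Euclidean space `ℝ^{m_1} × ⋯ × ℝ^{m_d}`, whose coordinates are indexed by the pairs
(block, coordinate inside the block). -/
abbrev BlockVec {d : ℕ} (m : Fin d → ℕ) : Type :=
  EuclideanSpace ℝ ((i : Fin d) × Fin (m i))

/-- Square matrices acting on `BlockVec m`. -/
abbrev BlockMat {d : ℕ} (m : Fin d → ℕ) : Type :=
  Matrix ((i : Fin d) × Fin (m i)) ((i : Fin d) × Fin (m i)) ℝ

/-- The `i`-th block `x_i` of a vector `x`. -/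
def block {d : ℕ} {m : Fin d → ℕ} (x : BlockVec m) (i : Fin d) : EuclideanSpace ℝ (Fin (m i)) :=
  WithLp.toLp 2 fun j => x ⟨i, j⟩

/-- The vector with the given blocks. -/
def ofBlocks {d : ℕ} {m : Fin d → ℕ} (u : (i : Fin d) → EuclideanSpace ℝ (Fin (m i))) :
    BlockVec m :=
  WithLp.toLp 2 fun a => u a.1 a.2

/-- The squared weighted norm `‖u‖²_Q = ⟨Q u, u⟩`. -/
def sqNorm {n : ℕ} (Q : Matrix (Fin n) (Fin n) ℝ) (u : EuclideanSpace ℝ (Fin n)) : ℝ :=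
  inner ℝ (Matrix.toEuclideanLin Q u) u

/-- `φ` is differentiable and `0 ≤ φ (x + t) - φ x - ⟨∇φ x, t⟩ ≤ ½ ‖t‖²_L` for all `x`, `t`
(so `φ` is convex, and smooth with matrix-valued modulus `L`). -/
def IsConvexSmooth {n : ℕ} (φ : EuclideanSpace ℝ (Fin n) → ℝ) (L : Matrix (Fin n) (Fin n) ℝ) :
    Prop :=
  Differentiable ℝ φ ∧ ∀ x t : EuclideanSpace ℝ (Fin n),
    0 ≤ φ (x + t) - φ x - inner ℝ (gradient φ x) t ∧
      φ (x + t) - φ x - inner ℝ (gradient φ x) t ≤ 1 / 2 * sqNorm L t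

/-- Proper, convex, lower semicontinuous functions with values in `(-∞, ∞]`. -/
structure IsProperConvexLsc {n : ℕ} (r : EuclideanSpace ℝ (Fin n) → EReal) : Prop where
  ne_bot : ∀ u, r u ≠ ⊥
  exists_ne_top : ∃ u, r u ≠ ⊤
  lsc : LowerSemicontinuous r
  convex : ∀ u v : EuclideanSpace ℝ (Fin n), ∀ s t : ℝ, 0 ≤ s → 0 ≤ t → s + t = 1 →
    r (s • u + t • v) ≤ (s : EReal) * r u + (t : EReal) * r v

section Objective

variable {d q : ℕ} {m : Fin d → ℕ}

/-- The smooth part `Φ(x) = ∑ i, φ_i(x_i)`. -/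
def Phi (φ : (i : Fin d) → EuclideanSpace ℝ (Fin (m i)) → ℝ) (x : BlockVec m) : ℝ :=
  ∑ i, φ i (block x i)

/-- The non-smooth part `R(x) = ∑ i, r_i(x_i)`. -/
def Reg (r : (i : Fin d) → EuclideanSpace ℝ (Fin (m i)) → EReal) (x : BlockVec m) : EReal :=
  ∑ i, r i (block x i)

/-- The objective `Ψ = Φ + R`. -/
def Psi (φ : (i : Fin d) → EuclideanSpace ℝ (Fin (m i)) → ℝ)
    (r : (i : Fin d) → EuclideanSpace ℝ (Fin (m i)) → EReal) (x : BlockVec m) : EReal :=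
  (Phi φ x : EReal) + Reg r x

/-- The least squares penalty `h(x) = ½ ‖A x - b‖²`. -/
def penalty (A : Matrix (Fin q) ((i : Fin d) × Fin (m i)) ℝ) (b : EuclideanSpace ℝ (Fin q))
    (x : BlockVec m) : ℝ :=
  1 / 2 * ‖Matrix.toEuclideanLin A x - b‖ ^ 2

/-- The feasible set `𝒳 = argmin h`. -/
def feasible (A : Matrix (Fin q) ((i : Fin d) × Fin (m i)) ℝ) (b : EuclideanSpace ℝ (Fin q)) :
    Set (BlockVec m) :=
  {x | ∀ u, penalty A b x ≤ penalty A b u}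

/-- The solution set `𝒳* = argmin {Ψ(x) : x ∈ 𝒳}`. -/
def solutions (φ : (i : Fin d) → EuclideanSpace ℝ (Fin (m i)) → ℝ)
    (r : (i : Fin d) → EuclideanSpace ℝ (Fin (m i)) → EReal)
    (A : Matrix (Fin q) ((i : Fin d) × Fin (m i)) ℝ) (b : EuclideanSpace ℝ (Fin q)) :
    Set (BlockVec m) :=
  {x | x ∈ feasible A b ∧ ∀ u ∈ feasible A b, Psi φ r x ≤ Psi φ r u}

/-- The convex subdifferential of a function with values in `(-∞, ∞]`, at a point of its
domain; it is empty outside the domain. -/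
def subdifferential (f : BlockVec m → EReal) (x : BlockVec m) : Set (BlockVec m) :=
  {ξ | f x ≠ ⊤ ∧ ∀ u, f x + ((inner ℝ ξ (u - x) : ℝ) : EReal) ≤ f u}

/-- `(x, y)` is a saddle point: `0 ∈ ∂Ψ(x) - AᵀA y` and `AᵀA x - Aᵀb = 0`. -/
def IsSaddlePoint (φ : (i : Fin d) → EuclideanSpace ℝ (Fin (m i)) → ℝ)
    (r : (i : Fin d) → EuclideanSpace ℝ (Fin (m i)) → EReal)
    (A : Matrix (Fin q) ((i : Fin d) × Fin (m i)) ℝ) (b : EuclideanSpace ℝ (Fin q))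
    (x y : BlockVec m) : Prop :=
  Matrix.toEuclideanLin (A.transpose * A) y ∈ subdifferential (Psi φ r) x ∧
    Matrix.toEuclideanLin (A.transpose * A) x = Matrix.toEuclideanLin A.transpose b

end Objective

section Sampling

variable {d q : ℕ} {m : Fin d → ℕ} {Ω : Type*} [MeasurableSpace Ω]

/-- The activation probabilities `π_i = ℙ(i ∈ I)` of a random sampling `I`. -/
def actProb (μ : Measure Ω) (I : Ω → Finset (Fin d)) (i : Fin d) : ℝ :=
  μ.real {ω | i ∈ I ω}

/-- The weighting matrix `P = blkdiag [π_i⁻¹ Id]`. -/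
def weightMat (m : Fin d → ℕ) (p : Fin d → ℝ) : BlockMat m :=
  Matrix.blockDiagonal' fun i => (1 / p i) • (1 : Matrix (Fin (m i)) (Fin (m i)) ℝ)

/-- The activation matrix `E` of a set `J` of blocks: the identity on the blocks in `J`, zero on
the others. -/
def activation (m : Fin d → ℕ) (J : Finset (Fin d)) : BlockMat m :=
  Matrix.blockDiagonal' fun i => if i ∈ J then (1 : Matrix (Fin (m i)) (Fin (m i)) ℝ) else 0

/-- The matrix `Ξ = 𝔼[E P Aᵀ A P E]`, the expectation being taken entry by entry. -/
def Xi (μ : Measure Ω) (I : Ω → Finset (Fin d)) (A : Matrix (Fin q) ((i : Fin d) × Fin (m i)) ℝ) :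
    BlockMat m :=
  Matrix.of fun a c => ∫ ω, (activation m (I ω) * weightMat m (actProb μ I) * A.transpose * A *
    weightMat m (actProb μ I) * activation m (I ω)) a c ∂μ

/-- `(ι_k)` are independent copies of the random sampling `I`. -/
structure IsIIDSampling (μ : Measure Ω) (I : Ω → Finset (Fin d)) (ι : ℕ → Ω → Finset (Fin d)) :
    Prop where
  measurable : Measurable I
  measurable_copy : ∀ k, Measurable (ι k)
  indep : iIndepFun ι μ
  ident : ∀ k, IdentDistrib (ι k) I μ μ

end Sampling

section Algorithm

variable {d q : ℕ} {m : Fin d → ℕ}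

/-- The weights `S_k = 1 + ∑_{t=1}^k σ_t`. -/
def S (σ : ℕ → ℝ) (k : ℕ) : ℝ := 1 + ∑ t ∈ Finset.Icc 1 k, σ t

/-- `θ_k = σ_k / S_k`. -/
def theta (σ : ℕ → ℝ) (k : ℕ) : ℝ := σ k / S σ k

/-- The forward-backward step of one block: the (unique, for positive definite `Q` and `r` proper,
convex and lower semicontinuous) minimiser of `u ↦ r(u) + ⟨g, u - x⟩ + ½ ‖u - x‖²_Q`. -/
def forwardBackward {n : ℕ} (r : EuclideanSpace ℝ (Fin n) → EReal) (Q : Matrix (Fin n) (Fin n) ℝ)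
    (g x : EuclideanSpace ℝ (Fin n)) : EuclideanSpace ℝ (Fin n) :=
  Classical.epsilon fun u => ∀ v,
    r u + ((inner ℝ g (u - x) + 1 / 2 * sqNorm Q (u - x) : ℝ) : EReal) ≤
      r v + ((inner ℝ g (v - x) + 1 / 2 * sqNorm Q (v - x) : ℝ) : EReal)

/-- The extrapolated point `z^k = (1 - θ_k) w^k + θ_k x^k`. -/
def zPoint (σ : ℕ → ℝ) (k : ℕ) (x w : BlockVec m) : BlockVec m :=
  (1 - theta σ k) • w + theta σ k • x

/-- The update `x^k ↦ x^{k+1}`: the blocks in `J` make a forward-backward step with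
`Q_i^k = (π_i τ_k)⁻¹ B_i` and `g_i^k = ∇φ_i(x_i^k) + S_k ∇_i h(z^k)`, the others do not move. -/
def xUpdate (φ : (i : Fin d) → EuclideanSpace ℝ (Fin (m i)) → ℝ)
    (r : (i : Fin d) → EuclideanSpace ℝ (Fin (m i)) → EReal)
    (A : Matrix (Fin q) ((i : Fin d) × Fin (m i)) ℝ) (b : EuclideanSpace ℝ (Fin q))
    (B : (i : Fin d) → Matrix (Fin (m i)) (Fin (m i)) ℝ) (p : Fin d → ℝ) (σ τ : ℕ → ℝ)
    (k : ℕ) (J : Finset (Fin d)) (x w : BlockVec m) : BlockVec m :=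
  ofBlocks fun i =>
    if i ∈ J then
      forwardBackward (r i) ((1 / (p i * τ k)) • B i)
        (gradient (φ i) (block x i) +
          S σ k • block (gradient (penalty A b) (zPoint σ k x w)) i)
        (block x i)
    else block x i

/-- The pair `(x^k, w^k)` produced by the algorithm from `x^0 = w^0 = x0` along a realisation
`(J_k)` of the sampling; `w^{k+1} = z^k + θ_k P (x^{k+1} - x^k)`. -/
def iterates (φ : (i : Fin d) → EuclideanSpace ℝ (Fin (m i)) → ℝ)
    (r : (i : Fin d) → EuclideanSpace ℝ (Fin (m i)) → EReal)
    (A : Matrix (Fin q) ((i : Fin d) × Fin (m i)) ℝ) (b : EuclideanSpace ℝ (Fin q))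
    (B : (i : Fin d) → Matrix (Fin (m i)) (Fin (m i)) ℝ) (p : Fin d → ℝ) (σ τ : ℕ → ℝ)
    (x0 : BlockVec m) (J : ℕ → Finset (Fin d)) : ℕ → BlockVec m × BlockVec m
  | 0 => (x0, x0)
  | k + 1 =>
    let x := (iterates φ r A b B p σ τ x0 J k).1
    let w := (iterates φ r A b B p σ τ x0 J k).2
    let x' := xUpdate φ r A b B p σ τ k (J k) x w
    (x', zPoint σ k x w + theta σ k • Matrix.toEuclideanLin (weightMat m p) (x' - x))

end Algorithm

end RBCD

end

/-! Write ψ_i = φ_i + r_i, s_k = S_{k-1} = 1 - σ + kσ, fix a dual solution y, and let x̂ be the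
point reached from x^k if every block were updated (`fullStep`). The proof is a stochastic Lyapunov
argument followed by a deterministic analysis of almost every realisation.

Summing the recursion for w^k shows that each block of w^k is a convex combination of the same block
of x^0, …, x^k; this is where σ ≤ π_i enters (`block_W_convex`). Jensen's inequality bounds s_k
Ψ(w^k) by a `surrogate` that is linear in the values ψ_i(x_i^j). Thanks to the weights 1/π_i, its
mean increment given the past is exactly σ Ψ(x̂). Likewise s_k A(w^k - x*) has an increment whose
conditional mean involves only x̂, and whose second moment is controlled by Ξ. The three-point
inequality of the proximal step, summed over the blocks (`fullStep_inequality`), then combines with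
PB ⪰ σΞ + Λ to give `integral_lyapunov_le`. The Lyapunov function V_k is the sum of the surrogate
gap, ½‖s_k A(w^k - x*)‖², the constant ½‖Ay‖² and a weighted squared distance from x^k to x*. It
decreases in conditional mean by at least a multiple of ‖A(x^k - x*)‖², of the slack in the descent
inequality for Φ, and of the Bregman distances from x* to x^k. The saddle inequality and a completed
square give V_k ≥ 0.

Robbins-Siegmund (`ae_tendsto_and_summable`) makes V_k convergent and the decreases summable almost
surely. Boundedness of V_k bounds s_k‖A(w^k - x*)‖ and s_k|Ψ(w^k) - Ψ(x*)|, and s_k grows like σk: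
these are the two rates. The decreases tend to zero, so A(x^k - x*) → 0 and x̂ - x^k → 0, and every
cluster point of x^k is a solution (`IsRegular.mem_solutions_of_tendsto`). Differences of V_k for
two solutions are differences of weighted distances, so an Opial-type argument over a countable
dense set of solutions leaves a single cluster point (`exists_tendsto_X`). Finally w^k is
asymptotically a Cesàro mean of the x^j, hence has the same limit (`tendsto_W`). -/

noncomputable section

namespace RBCD

/-! ### Supermartingale convergence for functionals of an i.i.d. sequence. -/

section RobbinsSiegmund

variable {Ω α : Type*}

/-- A functional of a sequence depending only on the first `k` terms. -/
def DependsOnPast {β : Type*} (k : ℕ) (F : (ℕ → α) → β) : Prop :=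
  ∀ J J' : ℕ → α, (∀ j < k, J j = J' j) → F J = F J'

theorem DependsOnPast.update {β : Type*} {k : ℕ} {F : (ℕ → α) → β} (hF : DependsOnPast k F)
    (J : ℕ → α) (a : α) : F (Function.update J k a) = F J :=
  hF _ _ fun _ hj => Function.update_of_ne hj.ne _ _

/-- The first `k` terms of a sequence of random variables. -/
def pastOf (ι : ℕ → Ω → α) (k : ℕ) (ω : Ω) : Fin k → α := fun j => ι j ω

/-- Prolongation of a finite sequence by a constant. -/
def extendPast (a₀ : α) {k : ℕ} (g : Fin k → α) : ℕ → α :=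
  fun j => if h : j < k then g ⟨j, h⟩ else a₀

/-- Factors the functional through `Fin k → α`, which is finite whenever `α` is, so that
measurability and integrability become automatic. -/
theorem DependsOnPast.eq_extendPast {β : Type*} {k : ℕ} {F : (ℕ → α) → β}
    (hF : DependsOnPast k F) (ι : ℕ → Ω → α) (a₀ : α) (ω : Ω) :
    F (fun j => ι j ω) = F (extendPast a₀ (pastOf ι k ω)) :=
  hF _ _ fun j hj => by simp [extendPast, pastOf, hj]

theorem DependsOnPast.eq_update {β : Type*} {k : ℕ} {F : (ℕ → α) → β}
    (hF : DependsOnPast (k + 1) F) (ι : ℕ → Ω → α) (a₀ : α) (ω : Ω) :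
    F (fun j => ι j ω) = F (Function.update (extendPast a₀ (pastOf ι k ω)) k (ι k ω)) :=
  hF _ _ fun j hj => by
    rcases Nat.lt_succ_iff_lt_or_eq.1 hj with h | h
    · rw [Function.update_of_ne h.ne]
      simp [extendPast, pastOf, h]
    · subst h
      simp

variable [MeasurableSpace Ω] [MeasurableSpace α]

/-- The filtration generated by a sequence of random variables, strictly before time `k`. -/
def pastFiltration (ι : ℕ → Ω → α) (hι : ∀ k, Measurable (ι k)) :
    Filtration ℕ (inferInstance : MeasurableSpace Ω) where
  seq k := MeasurableSpace.comap (pastOf ι k) inferInstance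
  mono' k l hkl := by
    rintro s ⟨t, ht, rfl⟩
    refine ⟨(fun g : Fin l → α => fun j : Fin k => g (Fin.castLE hkl j)) ⁻¹' t, ?_, rfl⟩
    exact (measurable_pi_lambda _ fun j => measurable_pi_apply _) ht
  le' k := by
    rintro s ⟨t, ht, rfl⟩
    exact (measurable_pi_lambda (pastOf ι k) fun j => hι j) ht

variable {μ : Measure Ω}

theorem indepFun_pastOf {ι : ℕ → Ω → α} (hι : ∀ k, Measurable (ι k)) (hind : iIndepFun ι μ)
    (k : ℕ) : IndepFun (pastOf ι k) (ι k) μ := by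
  have h := iIndepFun.indepFun_finset (Finset.range k) {k} (by simp) hind hι
  have hm₁ : Measurable fun (g : Finset.range k → α) (j : Fin k) =>
      g ⟨j, Finset.mem_range.2 j.2⟩ := measurable_pi_lambda _ fun j => measurable_pi_apply _
  have hm₂ : Measurable fun g : ({k} : Finset ℕ) → α => g ⟨k, Finset.mem_singleton_self k⟩ :=
    measurable_pi_apply _
  exact h.comp hm₁ hm₂

variable [IsProbabilityMeasure μ] [Finite α] [MeasurableSingletonClass α]

/-- Nonnegative supermartingale convergence for nonanticipating functionals of an i.i.d. sequence
with finitely many values. -/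
theorem ae_tendsto_of_integral_update_le {ι : ℕ → Ω → α} (hι : ∀ k, Measurable (ι k))
    (hind : iIndepFun ι μ) {ν : Measure α} (hν : ∀ k, μ.map (ι k) = ν)
    {G : ℕ → (ℕ → α) → ℝ} (hG : ∀ k, DependsOnPast k (G k)) (hpos : ∀ k J, 0 ≤ G k J)
    (hstep : ∀ k J, ∫ a, G (k + 1) (Function.update J k a) ∂ν ≤ G k J) :
    ∀ᵐ ω ∂μ, ∃ l, Tendsto (fun k => G k fun j => ι j ω) atTop (𝓝 l) := by
  have hne : Nonempty α := by
    obtain ⟨ω⟩ : Nonempty Ω := nonempty_of_isProbabilityMeasure μ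
    exact ⟨ι 0 ω⟩
  obtain ⟨a₀⟩ := hne
  have hνp : IsProbabilityMeasure ν := by
    rw [← hν 0]; exact Measure.isProbabilityMeasure_map (hι 0).aemeasurable
  have hpast : ∀ k, Measurable (pastOf ι k) := fun k => measurable_pi_lambda _ fun j => hι j
  have hadapt : StronglyAdapted (pastFiltration ι hι) fun k ω => G k fun j => ι j ω := by
    intro k
    have : (fun ω => G k fun j => ι j ω) =
        (fun g : Fin k → α => G k (extendPast a₀ g)) ∘ pastOf ι k := by
      funext ω
      exact (hG k).eq_extendPast ι a₀ ω
    simp only [this]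
    exact StronglyMeasurable.of_discrete.comp_measurable (comap_measurable _)
  have hint : ∀ k, Integrable (fun ω => G k fun j => ι j ω) μ := by
    intro k
    have : (fun ω => G k fun j => ι j ω) =
        (fun g : Fin k → α => G k (extendPast a₀ g)) ∘ pastOf ι k := by
      funext ω
      exact (hG k).eq_extendPast ι a₀ ω
    rw [this]
    exact Integrable.comp_measurable Integrable.of_finite (hpast k)
  have hset : ∀ k, ∀ s : Set Ω, MeasurableSet[pastFiltration ι hι k] s →
      ∫ ω in s, G (k + 1) (fun j => ι j ω) ∂μ ≤ ∫ ω in s, G k (fun j => ι j ω) ∂μ := by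
    rintro k s ⟨t, ht, rfl⟩
    have hms : MeasurableSet (pastOf ι k ⁻¹' t) := hpast k ht
    -- By independence the joint law of the past and the next term is a product. Fubini then turns
    -- the conditional expectation into the integral over the k-th coordinate, which is the form of
    -- `hstep`.
    have hprod := (indepFun_iff_map_prod_eq_prod_map_map (hpast k).aemeasurable
      (hι k).aemeasurable).1 (indepFun_pastOf hι hind k)
    rw [hν k] at hprod
    have : IsProbabilityMeasure (μ.map (pastOf ι k)) :=
      Measure.isProbabilityMeasure_map (hpast k).aemeasurable
    rw [← integral_indicator hms, ← integral_indicator hms]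
    have h1 : (pastOf ι k ⁻¹' t).indicator (fun ω => G (k + 1) fun j => ι j ω) =
        fun ω => (fun p : (Fin k → α) × α => t.indicator
          (fun g => G (k + 1) (Function.update (extendPast a₀ g) k p.2)) p.1)
            (pastOf ι k ω, ι k ω) := by
      funext ω
      by_cases h : pastOf ι k ω ∈ t
      · simp only [Set.indicator, Set.mem_preimage, h, if_true]
        exact (hG (k + 1)).eq_update ι a₀ ω
      · simp [Set.indicator, h]
    have h2 : (pastOf ι k ⁻¹' t).indicator (fun ω => G k fun j => ι j ω) =
        fun ω => (t.indicator fun g => G k (extendPast a₀ g)) (pastOf ι k ω) := by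
      funext ω
      by_cases h : pastOf ι k ω ∈ t
      · simp only [Set.indicator, Set.mem_preimage, h, if_true]
        exact (hG k).eq_extendPast ι a₀ ω
      · simp [Set.indicator, h]
    rw [h1, h2, ← integral_map (φ := fun ω => (pastOf ι k ω, ι k ω))
        ((hpast k).prodMk (hι k)).aemeasurable
        StronglyMeasurable.of_discrete.aestronglyMeasurable, hprod,
      integral_prod _ Integrable.of_finite,
      ← integral_map (hpast k).aemeasurable StronglyMeasurable.of_discrete.aestronglyMeasurable]
    refine integral_mono Integrable.of_finite Integrable.of_finite fun g => ?_
    by_cases h : g ∈ t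
    · simp only [Set.indicator, h, if_true]
      exact hstep k _
    · simp [Set.indicator, h]
  have hsuper := supermartingale_of_setIntegral_succ_le hadapt hint hset
  have hbdd : ∀ n, eLpNorm ((-fun k ω => G k fun j => ι j ω) n) 1 μ ≤
      ((∫ ω, G 0 (fun j => ι j ω) ∂μ).toNNReal : ENNReal) := by
    intro n
    have hle : ∫ ω, G n (fun j => ι j ω) ∂μ ≤ ∫ ω, G 0 (fun j => ι j ω) ∂μ := by
      simpa using hsuper.setIntegral_le (Nat.zero_le n) MeasurableSet.univ
    rw [eLpNorm_one_eq_lintegral_enorm]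
    have : ∫⁻ ω, ‖(-fun k ω => G k fun j => ι j ω) n ω‖ₑ ∂μ =
        ENNReal.ofReal (∫ ω, G n (fun j => ι j ω) ∂μ) := by
      rw [ofReal_integral_eq_lintegral_ofReal (hint n) (ae_of_all _ fun ω => hpos n _)]
      refine lintegral_congr fun ω => ?_
      simp only [Pi.neg_apply, enorm_neg]
      exact Real.enorm_of_nonneg (hpos n _)
    rw [this]
    exact ENNReal.ofReal_le_ofReal hle
  filter_upwards [hsuper.neg.exists_ae_tendsto_of_bdd hbdd] with ω hω
  obtain ⟨c, hc⟩ := hω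
  exact ⟨-c, by simpa using hc.neg⟩

/-- The Robbins-Siegmund theorem for nonanticipating functionals of an i.i.d. sequence with
finitely many values. -/
theorem ae_tendsto_and_summable {ι : ℕ → Ω → α} (hι : ∀ k, Measurable (ι k))
    (hind : iIndepFun ι μ) {ν : Measure α} (hν : ∀ k, μ.map (ι k) = ν)
    {F δ : ℕ → (ℕ → α) → ℝ} (hF : ∀ k, DependsOnPast k (F k)) (hδ : ∀ k, DependsOnPast k (δ k))
    (hFpos : ∀ k J, 0 ≤ F k J) (hδpos : ∀ k J, 0 ≤ δ k J)
    (hstep : ∀ k J, ∫ a, F (k + 1) (Function.update J k a) ∂ν + δ k J ≤ F k J) :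
    ∀ᵐ ω ∂μ, (∃ l, Tendsto (fun k => F k fun j => ι j ω) atTop (𝓝 l)) ∧
      Summable fun k => δ k fun j => ι j ω := by
  have hνp : IsProbabilityMeasure ν := by
    rw [← hν 0]; exact Measure.isProbabilityMeasure_map (hι 0).aemeasurable
  have hpart : ∀ k l, k ≤ l → DependsOnPast l fun J => ∑ j ∈ Finset.range k, δ j J := by
    intro k l hkl J J' h
    refine Finset.sum_congr rfl fun j hj => hδ j _ _ fun i hi => h i ?_
    have := Finset.mem_range.1 hj
    omega
  -- Adding the past decreases to `F` gives a nonnegative supermartingale. Its boundedness along a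
  -- path bounds the partial sums of `δ`.
  have hG := ae_tendsto_of_integral_update_le (μ := μ) hι hind hν
    (G := fun k J => F k J + ∑ j ∈ Finset.range k, δ j J)
    (fun k J J' h => by
      have h1 := hF k J J' h
      have h2 := hpart k k le_rfl J J' h
      simp only at h2 ⊢
      rw [h1, h2])
    (fun k J => add_nonneg (hFpos k J) (Finset.sum_nonneg fun j _ => hδpos j J))
    (fun k J => by
      rw [integral_add Integrable.of_finite Integrable.of_finite]
      have : ∀ a, ∑ j ∈ Finset.range (k + 1), δ j (Function.update J k a) =
          ∑ j ∈ Finset.range (k + 1), δ j J := fun a => Finset.sum_congr rfl fun j hj =>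
        hδ j _ _ fun i hi => Function.update_of_ne (by have := Finset.mem_range.1 hj; omega) _ _
      simp only [this, integral_const, probReal_univ, one_smul]
      rw [Finset.sum_range_succ]
      linarith [hstep k J])
  filter_upwards [hG] with ω hω
  obtain ⟨l, hl⟩ := hω
  have hsum : Summable fun k => δ k fun j => ι j ω := by
    obtain ⟨C, hC⟩ := hl.bddAbove_range
    refine summable_of_sum_range_le (c := C) (fun k => hδpos k _) fun n => ?_
    have := hC ⟨n, rfl⟩
    simp only at this
    linarith [hFpos n fun j => ι j ω]
  refine ⟨⟨_, (hl.sub hsum.hasSum.tendsto_sum_nat).congr fun k => ?_⟩, hsum⟩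
  simp

end RobbinsSiegmund

/-! ### Quadratic forms of positive definite matrices. -/

section WeightedNorm

variable {n : ℕ} {Q : Matrix (Fin n) (Fin n) ℝ}

theorem inner_toEuclideanLin_eq_dotProduct {ι κ : Type*} [Fintype ι] [Fintype κ] [DecidableEq κ]
    (M : Matrix ι κ ℝ) (u : EuclideanSpace ℝ κ) (v : EuclideanSpace ℝ ι) :
    inner ℝ (Matrix.toEuclideanLin M u) v = v.ofLp ⬝ᵥ M.mulVec u.ofLp := by
  simp [Matrix.toLpLin_apply, PiLp.inner_apply, dotProduct]

theorem inner_toEuclideanLin_transpose {ι κ : Type*} [Fintype ι] [Fintype κ] [DecidableEq κ]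
    [DecidableEq ι] (M : Matrix ι κ ℝ) (u : EuclideanSpace ℝ ι) (v : EuclideanSpace ℝ κ) :
    inner ℝ (Matrix.toEuclideanLin M.transpose u) v = inner ℝ u (Matrix.toEuclideanLin M v) := by
  rw [inner_toEuclideanLin_eq_dotProduct, real_inner_comm, inner_toEuclideanLin_eq_dotProduct,
    Matrix.mulVec_transpose, dotProduct_comm, Matrix.dotProduct_mulVec]

theorem toEuclideanLin_mul {ι κ l : Type*} [Fintype ι] [Fintype κ] [DecidableEq κ] [Fintype l]
    [DecidableEq l] (M : Matrix ι κ ℝ) (N : Matrix κ l ℝ) (u : EuclideanSpace ℝ l) :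
    Matrix.toEuclideanLin (M * N) u = Matrix.toEuclideanLin M (Matrix.toEuclideanLin N u) := by
  simp [Matrix.toLpLin_apply, Matrix.mulVec_mulVec]

theorem sqNorm_zero : sqNorm Q 0 = 0 := by simp [sqNorm]

theorem sqNorm_smul (c : ℝ) (u : EuclideanSpace ℝ (Fin n)) :
    sqNorm Q (c • u) = c ^ 2 * sqNorm Q u := by
  simp only [sqNorm, map_smul, inner_smul_left, inner_smul_right]
  simp; ring

theorem sqNorm_smul_matrix (c : ℝ) (u : EuclideanSpace ℝ (Fin n)) :
    sqNorm (c • Q) u = c * sqNorm Q u := by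
  simp [sqNorm, inner_smul_left]

theorem sqNorm_add (hQ : Q.PosDef) (u v : EuclideanSpace ℝ (Fin n)) :
    sqNorm Q (u + v) = sqNorm Q u + 2 * inner ℝ (Matrix.toEuclideanLin Q u) v + sqNorm Q v := by
  have hs : Q.transpose = Q := by
    have := hQ.1
    rwa [Matrix.IsHermitian, Matrix.conjTranspose_eq_transpose_of_trivial] at this
  have h : inner ℝ (Matrix.toEuclideanLin Q v) u = inner ℝ (Matrix.toEuclideanLin Q u) v := by
    conv_lhs => rw [← hs]
    rw [inner_toEuclideanLin_transpose, real_inner_comm]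
  simp only [sqNorm, map_add, inner_add_left, inner_add_right, h]
  ring

theorem sqNorm_pos (hQ : Q.PosDef) {u : EuclideanSpace ℝ (Fin n)} (hu : u ≠ 0) :
    0 < sqNorm Q u := by
  rw [sqNorm, inner_toEuclideanLin_eq_dotProduct]
  have := hQ.dotProduct_mulVec_pos (x := u.ofLp) (by simpa using hu)
  simpa using this

theorem sqNorm_nonneg (hQ : Q.PosDef) (u : EuclideanSpace ℝ (Fin n)) : 0 ≤ sqNorm Q u := by
  rcases eq_or_ne u 0 with rfl | h
  · rw [sqNorm_zero]
  · exact (sqNorm_pos hQ h).le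

theorem continuous_sqNorm : Continuous (sqNorm Q) := by
  unfold sqNorm
  exact (LinearMap.continuous_of_finiteDimensional _).inner continuous_id

theorem exists_sqNorm_le (Q : Matrix (Fin n) (Fin n) ℝ) :
    ∃ C, 0 < C ∧ ∀ u, sqNorm Q u ≤ C * ‖u‖ ^ 2 := by
  set T := LinearMap.toContinuousLinearMap (Matrix.toEuclideanLin Q) with hT
  refine ⟨‖T‖ + 1, by positivity, fun u => ?_⟩
  have h1 : sqNorm Q u ≤ ‖T u‖ * ‖u‖ := real_inner_le_norm _ _
  have h2 := T.le_opNorm u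
  nlinarith [norm_nonneg u, sq_nonneg ‖u‖, mul_le_mul_of_nonneg_right h2 (norm_nonneg u)]

/-- The constant is the minimum of the form on the compact unit sphere, extended by homogeneity. The
sphere is empty in dimension zero, whence the case distinction. -/
theorem exists_le_sqNorm (hQ : Q.PosDef) : ∃ c, 0 < c ∧ ∀ u, c * ‖u‖ ^ 2 ≤ sqNorm Q u := by
  rcases (Metric.sphere (0 : EuclideanSpace ℝ (Fin n)) 1).eq_empty_or_nonempty with h | h
  · refine ⟨1, one_pos, fun u => ?_⟩
    have hu : u = 0 := by
      by_contra hne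
      have : ‖u‖⁻¹ • u ∈ Metric.sphere (0 : EuclideanSpace ℝ (Fin n)) 1 := by
        simp [norm_smul, hne]
      simp [h] at this
    simp [hu, sqNorm_zero]
  · obtain ⟨v, hv, hmin⟩ := (isCompact_sphere (0 : EuclideanSpace ℝ (Fin n)) 1).exists_isMinOn h
      (continuous_sqNorm (Q := Q)).continuousOn
    have hv1 : ‖v‖ = 1 := by simpa using hv
    refine ⟨sqNorm Q v, sqNorm_pos hQ (by rintro rfl; simp at hv1), fun u => ?_⟩
    rcases eq_or_ne u 0 with rfl | hu
    · simp [sqNorm_zero]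
    · have hn : ‖u‖ ≠ 0 := by simpa using hu
      have := hmin (show ‖u‖⁻¹ • u ∈ Metric.sphere (0 : EuclideanSpace ℝ (Fin n)) 1 by
        simp [norm_smul, hn])
      simp only [Set.mem_ofPred_eq, sqNorm_smul] at this
      calc sqNorm Q v * ‖u‖ ^ 2 ≤ (‖u‖⁻¹ ^ 2 * sqNorm Q u) * ‖u‖ ^ 2 := by gcongr
        _ = sqNorm Q u := by field_simp

end WeightedNorm

/-! ### Existence and three-point inequality for the proximal step. -/

section Prox

variable {n : ℕ} {r : EuclideanSpace ℝ (Fin n) → EReal}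

theorem IsProperConvexLsc.toReal_le (hr : IsProperConvexLsc r) {u v : EuclideanSpace ℝ (Fin n)}
    (hu : r u ≠ ⊤) (hv : r v ≠ ⊤) {s t : ℝ} (hs : 0 ≤ s) (ht : 0 ≤ t) (hst : s + t = 1) :
    r (s • u + t • v) ≠ ⊤ ∧
      (r (s • u + t • v)).toReal ≤ s * (r u).toReal + t * (r v).toReal := by
  have h := hr.convex u v s t hs ht hst
  have hc : (s : EReal) * r u + (t : EReal) * r v =
      ((s * (r u).toReal + t * (r v).toReal : ℝ) : EReal) := by
    rw [← EReal.coe_toReal hu (hr.ne_bot u), ← EReal.coe_toReal hv (hr.ne_bot v)]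
    norm_cast
  rw [hc] at h
  refine ⟨fun h' => ?_, ?_⟩
  · rw [h', top_le_iff] at h
    exact EReal.coe_ne_top _ h
  · exact EReal.toReal_le_toReal h (hr.ne_bot _) (EReal.coe_ne_top _)

theorem IsProperConvexLsc.convexOn (hr : IsProperConvexLsc r) :
    ConvexOn ℝ {u | r u ≠ ⊤} fun u => (r u).toReal :=
  ⟨fun _ hu _ hv _ _ hs ht hst => (hr.toReal_le hu hv hs ht hst).1,
    fun _ hu _ hv _ _ hs ht hst => (hr.toReal_le hu hv hs ht hst).2⟩

/-- A proper convex lower semicontinuous function decreases at most linearly. -/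
theorem IsProperConvexLsc.exists_linear_lower_bound (hr : IsProperConvexLsc r)
    {u₀ : EuclideanSpace ℝ (Fin n)} (hu₀ : r u₀ ≠ ⊤) :
    ∃ C : ℝ, 0 ≤ C ∧ ∀ u, r u ≠ ⊤ → -(C * (1 + ‖u - u₀‖)) ≤ (r u).toReal := by
  obtain ⟨a, -, ha⟩ := (hr.lsc.lowerSemicontinuousOn (Metric.closedBall u₀ 1)).exists_isMinOn
    ⟨u₀, by simp⟩ (isCompact_closedBall u₀ 1)
  have ha_top : r a ≠ ⊤ := ne_top_of_le_ne_top hu₀ (ha (by simp))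
  set M := |(r a).toReal| + |(r u₀).toReal| with hM
  have hball : ∀ v ∈ Metric.closedBall u₀ 1, r v ≠ ⊤ → -M ≤ (r v).toReal := fun v hv hvt => by
    have := EReal.toReal_le_toReal (ha hv) (hr.ne_bot a) hvt
    linarith [neg_abs_le (r a).toReal, abs_nonneg (r u₀).toReal]
  have hM0 : 0 ≤ M := by positivity
  refine ⟨2 * M, by positivity, fun u hu => ?_⟩
  rcases le_or_gt ‖u - u₀‖ 1 with h | h
  · have := hball u (by simpa [dist_eq_norm] using h) hu
    nlinarith [norm_nonneg (u - u₀)]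
  · set ρ := ‖u - u₀‖ with hρ
    have hρ0 : 0 < ρ := by linarith
    have hinv : ρ⁻¹ ≤ 1 := inv_le_one_of_one_le₀ h.le
    -- The point at distance one from `u₀` on the segment towards `u` lies in the ball where `r` is
    -- bounded below; convexity extrapolates the bound to `u`.
    obtain ⟨h1, h2⟩ := hr.toReal_le hu₀ hu (s := 1 - ρ⁻¹) (t := ρ⁻¹) (by linarith)
      (by positivity) (by ring)
    have h3 := hball _ (by
      rw [mem_closedBall_iff_norm]
      have : (1 - ρ⁻¹) • u₀ + ρ⁻¹ • u - u₀ = ρ⁻¹ • (u - u₀) := by module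
      rw [this, norm_smul, ← hρ]
      simp [abs_of_pos hρ0, hρ0.ne']) h1
    have h4 : -M ≤ (1 - ρ⁻¹) * (r u₀).toReal + ρ⁻¹ * (r u).toReal := h3.trans h2
    have h5 : ρ * (-M) ≤ (ρ - 1) * (r u₀).toReal + (r u).toReal := by
      have := mul_le_mul_of_nonneg_left h4 hρ0.le
      have e : ρ * ((1 - ρ⁻¹) * (r u₀).toReal + ρ⁻¹ * (r u).toReal) =
          (ρ - 1) * (r u₀).toReal + (r u).toReal := by field_simp
      linarith
    have h6 : (r u₀).toReal ≤ M := by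
      linarith [le_abs_self (r u₀).toReal, abs_nonneg (r a).toReal]
    nlinarith

theorem continuousAt_add_coe {a : EReal} (y : ℝ) :
    ContinuousAt (fun p : EReal × EReal => p.1 + p.2) (a, (y : EReal)) :=
  EReal.continuousAt_add (Or.inr (EReal.coe_ne_bot y)) (Or.inr (EReal.coe_ne_top y))

/-- The quadratic term beats the at most linear decrease of `r`, so the objective is coercive and
lower semicontinuous and has a minimiser. This makes the choice in `forwardBackward` meaningful. -/
theorem forwardBackward_spec (hr : IsProperConvexLsc r) {Q : Matrix (Fin n) (Fin n) ℝ}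
    (hQ : Q.PosDef) (g x v : EuclideanSpace ℝ (Fin n)) :
    r (forwardBackward r Q g x) + ((inner ℝ g (forwardBackward r Q g x - x) +
        1 / 2 * sqNorm Q (forwardBackward r Q g x - x) : ℝ) : EReal) ≤
      r v + ((inner ℝ g (v - x) + 1 / 2 * sqNorm Q (v - x) : ℝ) : EReal) := by
  obtain ⟨u₀, hu₀⟩ := hr.exists_ne_top
  obtain ⟨C, hC, hlow⟩ := hr.exists_linear_lower_bound hu₀
  obtain ⟨c, hc, hcQ⟩ := exists_le_sqNorm hQ
  set f : EuclideanSpace ℝ (Fin n) → ℝ := fun u => inner ℝ g (u - x) + 1 / 2 * sqNorm Q (u - x)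
    with hf
  have hfc : Continuous f := by
    have := continuous_sqNorm (Q := Q)
    fun_prop
  have hlsc : LowerSemicontinuous fun u => r u + (f u : EReal) :=
    hr.lsc.add' (continuous_coe_real_ereal.comp hfc).lowerSemicontinuous
      fun u => continuousAt_add_coe _
  set K := (r u₀).toReal + f u₀ with hK
  -- Beyond this radius (c/2)‖u - x‖² exceeds all the linear losses plus the value `K` at `u₀`; the
  -- last summand puts `u₀` inside the ball.
  set ρ := 1 + (2 * (C + ‖g‖ + 1) + 2 * (|K| + C * (1 + ‖x - u₀‖) + 1)) / c + ‖u₀ - x‖ with hρ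
  have hfar : ∀ u, r u ≠ ⊤ → ρ < ‖u - x‖ → K < (r u).toReal + f u := by
    intro u hu hlt
    have h1 := hlow u hu
    have h2 : -(‖g‖ * ‖u - x‖) ≤ inner ℝ g (u - x) :=
      (abs_le.1 (abs_real_inner_le_norm g (u - x))).1
    have h3 := hcQ (u - x)
    have h4 : ‖u - u₀‖ ≤ ‖u - x‖ + ‖x - u₀‖ := norm_sub_le_norm_sub_add_norm_sub _ _ _
    set N := ‖u - x‖
    have hN1 : 1 ≤ N := by
      have : 0 ≤ (2 * (C + ‖g‖ + 1) + 2 * (|K| + C * (1 + ‖x - u₀‖) + 1)) / c := by positivity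
      linarith [norm_nonneg (u₀ - x)]
    have hN : (2 * (C + ‖g‖ + 1) + 2 * (|K| + C * (1 + ‖x - u₀‖) + 1)) ≤ c * N := by
      have : (2 * (C + ‖g‖ + 1) + 2 * (|K| + C * (1 + ‖x - u₀‖) + 1)) / c ≤ N := by
        linarith [norm_nonneg (u₀ - x)]
      rw [div_le_iff₀ hc] at this
      linarith
    have h5 : C * ‖u - u₀‖ ≤ C * (N + ‖x - u₀‖) := by gcongr
    have h6 : (2 * (C + ‖g‖ + 1) + 2 * (|K| + C * (1 + ‖x - u₀‖) + 1)) * N ≤ c * N * N := by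
      gcongr
    have h7 : 2 * (|K| + C * (1 + ‖x - u₀‖) + 1) ≤ 2 * (|K| + C * (1 + ‖x - u₀‖) + 1) * N :=
      le_mul_of_one_le_right (by positivity) hN1
    simp only [hf]
    nlinarith [le_abs_self K]
  have hex : ∃ u, ∀ v, r u + (f u : EReal) ≤ r v + (f v : EReal) := by
    have hmem : u₀ ∈ Metric.closedBall x ρ := by
      rw [mem_closedBall_iff_norm]
      have : 0 ≤ (2 * (C + ‖g‖ + 1) + 2 * (|K| + C * (1 + ‖x - u₀‖) + 1)) / c := by positivity
      linarith
    obtain ⟨a, -, ha⟩ := (hlsc.lowerSemicontinuousOn (Metric.closedBall x ρ)).exists_isMinOn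
      ⟨u₀, hmem⟩ (isCompact_closedBall x ρ)
    refine ⟨a, fun v => ?_⟩
    by_cases hv : v ∈ Metric.closedBall x ρ
    · exact ha hv
    · by_cases hvt : r v = ⊤
      · rw [hvt, EReal.top_add_coe]; exact le_top
      · refine (ha hmem).trans ?_
        have := hfar v hvt (by simpa [dist_eq_norm] using hv)
        simp only
        rw [← EReal.coe_toReal hvt (hr.ne_bot v), ← EReal.coe_toReal hu₀ (hr.ne_bot u₀)]
        exact_mod_cast this.le
  exact Classical.epsilon_spec hex v

theorem forwardBackward_ne_top (hr : IsProperConvexLsc r) {Q : Matrix (Fin n) (Fin n) ℝ}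
    (hQ : Q.PosDef) (g x : EuclideanSpace ℝ (Fin n)) : r (forwardBackward r Q g x) ≠ ⊤ := by
  obtain ⟨u₀, hu₀⟩ := hr.exists_ne_top
  intro h
  have := forwardBackward_spec hr hQ g x u₀
  rw [h, EReal.top_add_coe, top_le_iff, ← EReal.coe_toReal hu₀ (hr.ne_bot u₀)] at this
  exact EReal.coe_ne_top _ (by exact_mod_cast this)

/-- The three-point inequality of a forward-backward step. -/
theorem forwardBackward_three_point (hr : IsProperConvexLsc r) {Q : Matrix (Fin n) (Fin n) ℝ}
    (hQ : Q.PosDef) (g x : EuclideanSpace ℝ (Fin n)) {v : EuclideanSpace ℝ (Fin n)}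
    (hv : r v ≠ ⊤) :
    (r (forwardBackward r Q g x)).toReal + inner ℝ g (forwardBackward r Q g x - v) ≤
      (r v).toReal + 1 / 2 * (sqNorm Q (v - x) - sqNorm Q (v - forwardBackward r Q g x) -
        sqNorm Q (forwardBackward r Q g x - x)) := by
  set p := forwardBackward r Q g x with hp
  have hpt : r p ≠ ⊤ := forwardBackward_ne_top hr hQ g x
  -- Minimality of `p` against the point (1 - t)p + tv, divided by t. Letting t tend to zero gives
  -- the variational inequality.
  have key : ∀ t : ℝ, 0 < t → t ≤ 1 →
      (r p).toReal + inner ℝ g (p - v) ≤ (r v).toReal +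
        inner ℝ (Matrix.toEuclideanLin Q (p - x)) (v - p) + t / 2 * sqNorm Q (v - p) := by
    intro t ht ht1
    obtain ⟨h1, h2⟩ := hr.toReal_le hpt hv (s := 1 - t) (t := t) (by linarith) ht.le (by ring)
    have h3 := forwardBackward_spec hr hQ g x ((1 - t) • p + t • v)
    rw [← hp, ← EReal.coe_toReal hpt (hr.ne_bot p), ← EReal.coe_toReal h1 (hr.ne_bot _)] at h3
    have h4 : (r p).toReal + (inner ℝ g (p - x) + 1 / 2 * sqNorm Q (p - x)) ≤
        (r ((1 - t) • p + t • v)).toReal + (inner ℝ g ((1 - t) • p + t • v - x) +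
          1 / 2 * sqNorm Q ((1 - t) • p + t • v - x)) := by exact_mod_cast h3
    have e1 : (1 - t) • p + t • v - x = (p - x) + t • (v - p) := by module
    rw [e1, sqNorm_add hQ, sqNorm_smul, inner_add_right, inner_smul_right, inner_smul_right] at h4
    have e2 : inner ℝ g (v - p) = - inner ℝ g (p - v) := by
      rw [← inner_neg_right, neg_sub]
    rw [e2] at h4
    have h5 : t * ((r p).toReal + inner ℝ g (p - v)) ≤ t * ((r v).toReal +
        inner ℝ (Matrix.toEuclideanLin Q (p - x)) (v - p) + t / 2 * sqNorm Q (v - p)) := by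
      nlinarith
    exact le_of_mul_le_mul_left h5 ht
  have hlim : (r p).toReal + inner ℝ g (p - v) ≤ (r v).toReal +
        inner ℝ (Matrix.toEuclideanLin Q (p - x)) (v - p) := by
    refine le_of_forall_pos_le_add fun ε hε => ?_
    have hq := sqNorm_nonneg hQ (v - p)
    have h := key (min 1 (ε / (sqNorm Q (v - p) + 1))) (by positivity) (min_le_left _ _)
    have h' : min 1 (ε / (sqNorm Q (v - p) + 1)) * (sqNorm Q (v - p) + 1) ≤ ε := by
      rw [← le_div_iff₀ (by positivity)]
      exact min_le_right _ _
    have h0 : 0 ≤ min 1 (ε / (sqNorm Q (v - p) + 1)) := by positivity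
    nlinarith
  have e : sqNorm Q (v - x) = sqNorm Q ((p - x) + (v - p)) := by congr 1; abel
  rw [e, sqNorm_add hQ]
  linarith

end Prox

/-! ### Bregman distances, cocoercivity and control of the step length. -/

section Smooth

variable {n : ℕ} {φ : EuclideanSpace ℝ (Fin n) → ℝ} {L : Matrix (Fin n) (Fin n) ℝ}

/-- The Bregman distance `φ u - φ v - ⟨∇φ v, u - v⟩`. -/
def bregman (φ : EuclideanSpace ℝ (Fin n) → ℝ) (u v : EuclideanSpace ℝ (Fin n)) : ℝ :=
  φ u - φ v - inner ℝ (gradient φ v) (u - v)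

theorem IsConvexSmooth.bregman_nonneg (hφ : IsConvexSmooth φ L) (u v : EuclideanSpace ℝ (Fin n)) :
    0 ≤ bregman φ u v := by
  have := (hφ.2 v (u - v)).1
  rwa [add_sub_cancel] at this

theorem IsConvexSmooth.bregman_le (hφ : IsConvexSmooth φ L) (u v : EuclideanSpace ℝ (Fin n)) :
    bregman φ u v ≤ 1 / 2 * sqNorm L (u - v) := by
  have := (hφ.2 v (u - v)).2
  rwa [add_sub_cancel] at this

theorem bregman_sub_bregman (φ : EuclideanSpace ℝ (Fin n) → ℝ)
    (p u x : EuclideanSpace ℝ (Fin n)) :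
    inner ℝ (gradient φ x) (p - u) = φ p - φ u - bregman φ p x + bregman φ u x := by
  have : p - u = (p - x) - (u - x) := by abel
  rw [this, inner_sub_right]
  unfold bregman
  ring

theorem IsConvexSmooth.convexOn (hφ : IsConvexSmooth φ L) : ConvexOn ℝ Set.univ φ := by
  refine ⟨convex_univ, fun u _ v _ s t hs ht hst => ?_⟩
  set z := s • u + t • v with hz
  have h1 := hφ.bregman_nonneg u z
  have h2 := hφ.bregman_nonneg v z
  unfold bregman at h1 h2
  have h3 : s * inner ℝ (gradient φ z) (u - z) + t * inner ℝ (gradient φ z) (v - z) = 0 := by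
    rw [← inner_smul_right, ← inner_smul_right, ← inner_add_right]
    have : s • (u - z) + t • (v - z) = (s • u + t • v) - (s + t) • z := by module
    rw [this, hst, one_smul, ← hz, sub_self, inner_zero_right]
  have h4 : φ z = s * φ z + t * φ z := by rw [← add_mul, hst, one_mul]
  simp only [smul_eq_mul]
  nlinarith [mul_nonneg hs h1, mul_nonneg ht h2]

/-- Cocoercivity of the gradient. -/
theorem IsConvexSmooth.exists_cocoercive (hφ : IsConvexSmooth φ L) :
    ∃ c, 0 < c ∧ ∀ u v, c * ‖gradient φ u - gradient φ v‖ ^ 2 ≤ bregman φ v u := by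
  obtain ⟨C, hC, hCL⟩ := exists_sqNorm_le L
  refine ⟨1 / (2 * C), by positivity, fun u v => ?_⟩
  set w := gradient φ u - gradient φ v with hw
  -- `v + t` is a gradient step of length 1/C from `v` for φ - ⟨∇φ(u), ·⟩, a function minimised at
  -- `u`.
  set t : EuclideanSpace ℝ (Fin n) := C⁻¹ • w with ht
  have h1 := (hφ.2 v t).2
  have h2 := hφ.bregman_nonneg (v + t) u
  have h3 := hCL t
  unfold bregman at h2 ⊢
  have e1 : inner ℝ (gradient φ u) (v + t - u) =
      inner ℝ (gradient φ u) (v - u) + inner ℝ (gradient φ u) t := by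
    rw [← inner_add_right]; congr 1; abel
  have e2 : inner ℝ (gradient φ u) t - inner ℝ (gradient φ v) t = C⁻¹ * ‖w‖ ^ 2 := by
    rw [← inner_sub_left, ← hw, ht, inner_smul_right, real_inner_self_eq_norm_sq]
  have e3 : C * ‖t‖ ^ 2 = C⁻¹ * ‖w‖ ^ 2 := by
    rw [ht, norm_smul, Real.norm_of_nonneg (by positivity)]; field_simp
  have e4 : 1 / (2 * C) * ‖w‖ ^ 2 = C⁻¹ * ‖w‖ ^ 2 - 1 / 2 * (C⁻¹ * ‖w‖ ^ 2) := by
    field_simp; ring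
  rw [e1] at h2
  rw [e4]
  linarith

/-- The step length is controlled by the slack in the descent inequality and the Bregman
distances to a reference point. -/
theorem IsConvexSmooth.exists_sq_norm_le (hφ : IsConvexSmooth φ L) (hL : L.PosDef) :
    ∃ C, 0 < C ∧ ∀ p x u, ‖p - x‖ ^ 2 ≤
      C * ((1 / 2 * sqNorm L (p - x) - bregman φ p x) + bregman φ u x + bregman φ u p) := by
  obtain ⟨l, hl, hlL⟩ := exists_le_sqNorm hL
  obtain ⟨c, hc, hcoc⟩ := hφ.exists_cocoercive
  refine ⟨4 / l * (1 + 2 / (l * c)), by positivity, fun p x u => ?_⟩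
  have h1 := hlL (p - x)
  have h2 := hcoc x u
  have h3 := hcoc p u
  have h4 := hφ.bregman_nonneg x p
  have h5 : bregman φ p x + bregman φ x p =
      inner ℝ (gradient φ p - gradient φ x) (p - x) := by
    have : x - p = -(p - x) := by abel
    unfold bregman
    rw [this, inner_neg_right, inner_sub_left]; ring
  have h6 : inner ℝ (gradient φ p - gradient φ x) (p - x) ≤
      (‖gradient φ p - gradient φ u‖ + ‖gradient φ x - gradient φ u‖) * ‖p - x‖ := by
    refine (real_inner_le_norm _ _).trans ?_
    gcongr
    rw [norm_sub_rev (gradient φ x)]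
    exact norm_sub_le_norm_sub_add_norm_sub _ _ _
  have hs := hφ.bregman_le p x
  set s := 1 / 2 * sqNorm L (p - x) - bregman φ p x with hs_def
  set α := ‖gradient φ p - gradient φ u‖
  set β := ‖gradient φ x - gradient φ u‖
  set N := ‖p - x‖
  have h7 : l / 2 * N ^ 2 ≤ s + (α + β) * N := by linarith
  -- Young's inequality, weighted so that half of the quadratic term of `h7` survives.
  have h8 : (α + β) * N ≤ l / 4 * N ^ 2 + 2 / l * (α ^ 2 + β ^ 2) := by
    have e : l / 4 * N ^ 2 + 2 / l * (α ^ 2 + β ^ 2) - (α + β) * N =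
        l / 4 * (N - 2 / l * (α + β)) ^ 2 + 1 / l * (α - β) ^ 2 := by field_simp; ring
    have : 0 ≤ l / 4 * (N - 2 / l * (α + β)) ^ 2 + 1 / l * (α - β) ^ 2 := by positivity
    linarith
  have h9 : 2 / l * (α ^ 2 + β ^ 2) ≤ 2 / (l * c) * (bregman φ u x + bregman φ u p) := by
    have : 2 / l * (α ^ 2 + β ^ 2) = 2 / (l * c) * (c * β ^ 2 + c * α ^ 2) := by
      field_simp; ring
    rw [this]; gcongr
  have hb := hφ.bregman_nonneg u x
  have hb' := hφ.bregman_nonneg u p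
  have h10 : l / 4 * N ^ 2 ≤ (1 + 2 / (l * c)) * (s + bregman φ u x + bregman φ u p) := by
    have : 0 ≤ 2 / (l * c) * s := by
      have : 0 ≤ s := by linarith
      positivity
    nlinarith
  calc N ^ 2 = 4 / l * (l / 4 * N ^ 2) := by field_simp
    _ ≤ 4 / l * ((1 + 2 / (l * c)) * (s + bregman φ u x + bregman φ u p)) := by gcongr
    _ = _ := by ring

end Smooth

/-! ### Block calculus and the second moment of the sampling. -/

section Blocks

variable {d q : ℕ} {m : Fin d → ℕ}

theorem block_add (x y : BlockVec m) (i : Fin d) : block (x + y) i = block x i + block y i := rfl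

theorem block_sub (x y : BlockVec m) (i : Fin d) : block (x - y) i = block x i - block y i := rfl

theorem block_smul (c : ℝ) (x : BlockVec m) (i : Fin d) : block (c • x) i = c • block x i := rfl

theorem block_sum {κ : Type*} (s : Finset κ) (f : κ → BlockVec m) (i : Fin d) :
    block (∑ j ∈ s, f j) i = ∑ j ∈ s, block (f j) i := by
  classical
  induction s using Finset.induction_on with
  | empty => rfl
  | insert a s ha ih => rw [Finset.sum_insert ha, Finset.sum_insert ha, block_add, ih]

theorem block_ofBlocks (u : (i : Fin d) → EuclideanSpace ℝ (Fin (m i))) (i : Fin d) :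
    block (ofBlocks u) i = u i := rfl

theorem block_ext {x y : BlockVec m} (h : ∀ i, block x i = block y i) : x = y := by
  ext ⟨i, j⟩
  have := congrArg (fun v : EuclideanSpace ℝ (Fin (m i)) => v j) (h i)
  simpa [block] using this

theorem continuous_block (i : Fin d) : Continuous fun x : BlockVec m => block x i := by
  unfold block
  fun_prop

theorem inner_eq_sum_block (x y : BlockVec m) :
    inner ℝ x y = ∑ i, inner ℝ (block x i) (block y i) := by
  simp only [PiLp.inner_apply, Fintype.sum_sigma, block]

theorem norm_sq_eq_sum_block (x : BlockVec m) : ‖x‖ ^ 2 = ∑ i, ‖block x i‖ ^ 2 := by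
  simp only [← real_inner_self_eq_norm_sq, inner_eq_sum_block]

theorem block_blockDiagonal' (M : (i : Fin d) → Matrix (Fin (m i)) (Fin (m i)) ℝ)
    (x : BlockVec m) (i : Fin d) :
    block (Matrix.toEuclideanLin (Matrix.blockDiagonal' M) x) i =
      Matrix.toEuclideanLin (M i) (block x i) := by
  ext j
  simp only [block, Matrix.toLpLin_apply, Matrix.mulVec, dotProduct, Fintype.sum_sigma]
  rw [Finset.sum_eq_single i]
  · simp
  · intro k _ hk
    refine Finset.sum_eq_zero fun l _ => ?_
    rw [Matrix.blockDiagonal'_apply_ne _ _ _ hk.symm, zero_mul]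
  · simp

theorem block_weightMat (p : Fin d → ℝ) (x : BlockVec m) (i : Fin d) :
    block (Matrix.toEuclideanLin (weightMat m p) x) i = (1 / p i) • block x i := by
  rw [weightMat, block_blockDiagonal', map_smul]
  simp

theorem block_activation (J : Finset (Fin d)) (x : BlockVec m) (i : Fin d) :
    block (Matrix.toEuclideanLin (activation m J) x) i = if i ∈ J then block x i else 0 := by
  rw [activation, block_blockDiagonal']
  split_ifs <;> simp

theorem inner_blockDiagonal' (M : (i : Fin d) → Matrix (Fin (m i)) (Fin (m i)) ℝ)
    (x : BlockVec m) :
    inner ℝ (Matrix.toEuclideanLin (Matrix.blockDiagonal' M) x) x =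
      ∑ i, sqNorm (M i) (block x i) := by
  simp only [inner_eq_sum_block, block_blockDiagonal', sqNorm]

theorem inner_weightMat_mul (p : Fin d → ℝ)
    (M : (i : Fin d) → Matrix (Fin (m i)) (Fin (m i)) ℝ) (x : BlockVec m) :
    inner ℝ (Matrix.toEuclideanLin (weightMat m p * Matrix.blockDiagonal' M) x) x =
      ∑ i, 1 / p i * sqNorm (M i) (block x i) := by
  simp only [inner_eq_sum_block, toEuclideanLin_mul, block_weightMat, block_blockDiagonal', sqNorm,
    inner_smul_left]
  simp

theorem weightMat_transpose (p : Fin d → ℝ) : (weightMat m p).transpose = weightMat m p := by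
  simp [weightMat, Matrix.blockDiagonal'_transpose]

theorem activation_transpose (J : Finset (Fin d)) :
    (activation m J).transpose = activation m J := by
  rw [activation, Matrix.blockDiagonal'_transpose]
  congr 1
  funext i
  split_ifs <;> simp

theorem inner_toEuclideanLin_eq_sum {κ : Type*} [Fintype κ] [DecidableEq κ] (M : Matrix κ κ ℝ)
    (v : EuclideanSpace ℝ κ) :
    inner ℝ (Matrix.toEuclideanLin M v) v = ∑ a, ∑ c, v a * (M a c * v c) := by
  rw [inner_toEuclideanLin_eq_dotProduct]
  simp [dotProduct, Matrix.mulVec, Finset.mul_sum]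

/-- The quadratic form of `Ξ` is the second moment of `A P E v`. -/
theorem inner_Xi {Ω : Type*} [MeasurableSpace Ω] (μ : Measure Ω) [IsProbabilityMeasure μ]
    {I : Ω → Finset (Fin d)} (hI : Measurable I) (A : Matrix (Fin q) ((i : Fin d) × Fin (m i)) ℝ)
    (v : BlockVec m) :
    inner ℝ (Matrix.toEuclideanLin (Xi μ I A) v) v =
      ∫ J, ‖Matrix.toEuclideanLin A (Matrix.toEuclideanLin (weightMat m (actProb μ I))
        (Matrix.toEuclideanLin (activation m J) v))‖ ^ 2 ∂(μ.map I) := by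
  have : IsProbabilityMeasure (μ.map I) := Measure.isProbabilityMeasure_map hI.aemeasurable
  set N : Finset (Fin d) → BlockMat m := fun J => activation m J * weightMat m (actProb μ I) *
    A.transpose * A * weightMat m (actProb μ I) * activation m J with hN
  have h1 : ∀ J, ‖Matrix.toEuclideanLin A (Matrix.toEuclideanLin (weightMat m (actProb μ I))
        (Matrix.toEuclideanLin (activation m J) v))‖ ^ 2 = ∑ a, ∑ c, v a * (N J a c * v c) := by
    intro J
    rw [← inner_toEuclideanLin_eq_sum, ← real_inner_self_eq_norm_sq]
    simp only [hN, toEuclideanLin_mul]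
    conv_rhs => rw [← activation_transpose, ← weightMat_transpose]
    simp only [inner_toEuclideanLin_transpose]
    simp only [activation_transpose, weightMat_transpose]
  simp only [h1]
  rw [inner_toEuclideanLin_eq_sum, integral_finsetSum _ fun a _ => Integrable.of_finite]
  refine Finset.sum_congr rfl fun a _ => ?_
  rw [integral_finsetSum _ fun a _ => Integrable.of_finite]
  refine Finset.sum_congr rfl fun c _ => ?_
  rw [integral_const_mul, integral_mul_const, integral_map hI.aemeasurable
    StronglyMeasurable.of_discrete.aestronglyMeasurable]
  rfl

end Blocks

/-! ### The least squares penalty and its minimisers. -/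

section Penalty

variable {d q : ℕ} {m : Fin d → ℕ} {A : Matrix (Fin q) ((i : Fin d) × Fin (m i)) ℝ}
  {b : EuclideanSpace ℝ (Fin q)}

theorem penalty_add (A : Matrix (Fin q) ((i : Fin d) × Fin (m i)) ℝ)
    (b : EuclideanSpace ℝ (Fin q)) (x v : BlockVec m) :
    penalty A b (x + v) = penalty A b x +
      inner ℝ (Matrix.toEuclideanLin A.transpose (Matrix.toEuclideanLin A x - b)) v +
      1 / 2 * ‖Matrix.toEuclideanLin A v‖ ^ 2 := by
  unfold penalty
  rw [inner_toEuclideanLin_transpose, map_add, add_sub_right_comm, norm_add_sq_real]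
  ring

theorem gradient_penalty (x : BlockVec m) :
    gradient (penalty A b) x =
      Matrix.toEuclideanLin A.transpose (Matrix.toEuclideanLin A x - b) := by
  set T := LinearMap.toContinuousLinearMap (Matrix.toEuclideanLin A) with hT
  refine HasGradientAt.gradient ?_
  rw [hasGradientAt_iff_hasFDerivAt, hasFDerivAt_iff_isLittleO_nhds_zero]
  have : ∀ v, penalty A b (x + v) - penalty A b x -
      (InnerProductSpace.toDual ℝ (BlockVec m)
        (Matrix.toEuclideanLin A.transpose (Matrix.toEuclideanLin A x - b))) v =
      1 / 2 * ‖Matrix.toEuclideanLin A v‖ ^ 2 := by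
    intro v
    rw [penalty_add, InnerProductSpace.toDual_apply_apply]
    ring
  simp only [this]
  have h2 : (fun v : BlockVec m => 1 / 2 * ‖Matrix.toEuclideanLin A v‖ ^ 2) =O[𝓝 0]
      fun v => ‖v‖ ^ 2 := by
    refine IsBigO.of_bound (‖T‖ ^ 2) (Eventually.of_forall fun v => ?_)
    have h := T.le_opNorm v
    rw [Real.norm_of_nonneg (by positivity), Real.norm_of_nonneg (by positivity), ← mul_pow]
    have h3 : ‖Matrix.toEuclideanLin A v‖ ^ 2 ≤ (‖T‖ * ‖v‖) ^ 2 := by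
      gcongr
      exact h
    nlinarith [sq_nonneg ‖Matrix.toEuclideanLin A v‖]
  exact h2.trans_isLittleO (isLittleO_norm_pow_id one_lt_two)

theorem mem_feasible_of_normal {x : BlockVec m}
    (hx : Matrix.toEuclideanLin A.transpose (Matrix.toEuclideanLin A x - b) = 0) :
    x ∈ feasible A b := by
  intro u
  have := penalty_add A b x (u - x)
  rw [hx, inner_zero_left, add_sub_cancel] at this
  rw [this]
  nlinarith [sq_nonneg ‖Matrix.toEuclideanLin A (u - x)‖]

theorem normal_of_saddle {x : BlockVec m}
    (hx : Matrix.toEuclideanLin (A.transpose * A) x = Matrix.toEuclideanLin A.transpose b) :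
    Matrix.toEuclideanLin A.transpose (Matrix.toEuclideanLin A x - b) = 0 := by
  rw [map_sub, ← hx, toEuclideanLin_mul, sub_self]

theorem penalty_sub_of_normal {x : BlockVec m}
    (hx : Matrix.toEuclideanLin A.transpose (Matrix.toEuclideanLin A x - b) = 0) (u : BlockVec m) :
    penalty A b u - penalty A b x = 1 / 2 * ‖Matrix.toEuclideanLin A (u - x)‖ ^ 2 := by
  have := penalty_add A b x (u - x)
  rw [hx, inner_zero_left, add_sub_cancel] at this
  rw [this]
  ring

/-- The excess penalty over a point satisfying the normal equations is exactly ½‖A(u - x)‖². -/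
theorem mem_feasible_iff_of_normal {x : BlockVec m}
    (hx : Matrix.toEuclideanLin A.transpose (Matrix.toEuclideanLin A x - b) = 0) {u : BlockVec m} :
    u ∈ feasible A b ↔ Matrix.toEuclideanLin A u = Matrix.toEuclideanLin A x := by
  constructor
  · intro hu
    have h1 := penalty_sub_of_normal hx u
    have h2 := hu x
    have h3 : ‖Matrix.toEuclideanLin A (u - x)‖ ^ 2 = 0 := by
      nlinarith [sq_nonneg ‖Matrix.toEuclideanLin A (u - x)‖]
    rw [← sub_eq_zero, ← map_sub]
    simpa using h3
  · intro hu
    exact mem_feasible_of_normal (by rw [hu, hx])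

theorem gradient_penalty_of_normal {x : BlockVec m}
    (hx : Matrix.toEuclideanLin A.transpose (Matrix.toEuclideanLin A x - b) = 0) (u : BlockVec m) :
    gradient (penalty A b) u =
      Matrix.toEuclideanLin A.transpose (Matrix.toEuclideanLin A (u - x)) := by
  rw [gradient_penalty, ← sub_zero (Matrix.toEuclideanLin A.transpose _), ← hx, ← map_sub]
  congr 1
  rw [map_sub]
  abel

end Penalty

/-! ### The objective, its domain, and saddle points. -/

section Objective

variable {d q : ℕ} {m : Fin d → ℕ} {φ : (i : Fin d) → EuclideanSpace ℝ (Fin (m i)) → ℝ}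
  {r : (i : Fin d) → EuclideanSpace ℝ (Fin (m i)) → EReal}

/-- The real-valued `i`-th summand `φ_i + r_i` of the objective. -/
def blockObj (φ : (i : Fin d) → EuclideanSpace ℝ (Fin (m i)) → ℝ)
    (r : (i : Fin d) → EuclideanSpace ℝ (Fin (m i)) → EReal) (i : Fin d)
    (u : EuclideanSpace ℝ (Fin (m i))) : ℝ :=
  φ i u + (r i u).toReal

/-- The real-valued objective. -/
def realObj (φ : (i : Fin d) → EuclideanSpace ℝ (Fin (m i)) → ℝ)
    (r : (i : Fin d) → EuclideanSpace ℝ (Fin (m i)) → EReal) (x : BlockVec m) : ℝ :=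
  ∑ i, blockObj φ r i (block x i)

/-- The domain of the objective. -/
def objDom (r : (i : Fin d) → EuclideanSpace ℝ (Fin (m i)) → EReal) : Set (BlockVec m) :=
  {x | ∀ i, r i (block x i) ≠ ⊤}

theorem sum_ne_bot {κ : Type*} (s : Finset κ) {f : κ → EReal} (hf : ∀ i ∈ s, f i ≠ ⊥) :
    ∑ i ∈ s, f i ≠ ⊥ := by
  classical
  induction s using Finset.induction_on with
  | empty => simp
  | insert a s ha ih =>
    rw [Finset.sum_insert ha, Ne, EReal.add_eq_bot_iff, not_or]
    exact ⟨hf a (by simp), ih fun i hi => hf i (Finset.mem_insert_of_mem hi)⟩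

theorem ne_top_of_sum_ne_top {κ : Type*} (s : Finset κ) {f : κ → EReal} (hf : ∀ i ∈ s, f i ≠ ⊥)
    (h : ∑ i ∈ s, f i ≠ ⊤) : ∀ i ∈ s, f i ≠ ⊤ := by
  classical
  intro i hi hfi
  apply h
  rw [← Finset.add_sum_erase s f hi, hfi]
  exact EReal.top_add_of_ne_bot (sum_ne_bot _ fun j hj => hf j (Finset.mem_of_mem_erase hj))

theorem sum_eq_coe_sum {κ : Type*} (s : Finset κ) {f : κ → EReal} (hf : ∀ i ∈ s, f i ≠ ⊥)
    (hf' : ∀ i ∈ s, f i ≠ ⊤) : ∑ i ∈ s, f i = ((∑ i ∈ s, (f i).toReal : ℝ) : EReal) := by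
  classical
  induction s using Finset.induction_on with
  | empty => simp
  | insert a s ha ih =>
    rw [Finset.sum_insert ha, Finset.sum_insert ha, EReal.coe_add,
      EReal.coe_toReal (hf' a (by simp)) (hf a (by simp)),
      ih (fun i hi => hf i (Finset.mem_insert_of_mem hi))
        (fun i hi => hf' i (Finset.mem_insert_of_mem hi))]

theorem mem_objDom_of_Reg_ne_top (hr : ∀ i, IsProperConvexLsc (r i)) {x : BlockVec m}
    (h : Reg r x ≠ ⊤) : x ∈ objDom r := fun i =>
  ne_top_of_sum_ne_top Finset.univ (f := fun i => r i (block x i))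
    (fun i _ => (hr i).ne_bot _) h i (Finset.mem_univ i)

theorem mem_objDom_of_Psi_ne_top (hr : ∀ i, IsProperConvexLsc (r i)) {x : BlockVec m}
    (h : Psi φ r x ≠ ⊤) : x ∈ objDom r :=
  mem_objDom_of_Reg_ne_top hr fun h' => h (by rw [Psi, h', EReal.coe_add_top])

theorem Psi_eq_realObj (hr : ∀ i, IsProperConvexLsc (r i)) {x : BlockVec m}
    (h : x ∈ objDom r) : Psi φ r x = ((realObj φ r x : ℝ) : EReal) := by
  rw [Psi, Reg, sum_eq_coe_sum _ (fun i _ => (hr i).ne_bot _) fun i _ => h i, ← EReal.coe_add, Phi,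
    ← Finset.sum_add_distrib]
  rfl

theorem lowerSemicontinuous_sum_of_ne_bot {X κ : Type*} [TopologicalSpace X] (s : Finset κ)
    {f : κ → X → EReal} (hf : ∀ i, LowerSemicontinuous (f i)) (hb : ∀ i x, f i x ≠ ⊥) :
    LowerSemicontinuous fun x => ∑ i ∈ s, f i x := by
  classical
  induction s using Finset.induction_on with
  | empty => simpa using lowerSemicontinuous_const
  | insert a s ha ih =>
    simp only [Finset.sum_insert ha]
    exact (hf a).add' ih fun x => EReal.continuousAt_add
      (Or.inr (sum_ne_bot s fun i _ => hb i x)) (Or.inl (hb a x))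

theorem lowerSemicontinuous_Psi {L : (i : Fin d) → Matrix (Fin (m i)) (Fin (m i)) ℝ}
    (hφ : ∀ i, IsConvexSmooth (φ i) (L i)) (hr : ∀ i, IsProperConvexLsc (r i)) :
    LowerSemicontinuous (Psi φ r) := by
  have hΦ : Continuous (Phi φ) :=
    continuous_finsetSum _ fun i _ => (hφ i).1.continuous.comp (continuous_block i)
  have hR : LowerSemicontinuous (Reg r) := lowerSemicontinuous_sum_of_ne_bot _
    (fun i => (hr i).lsc.comp (continuous_block i)) fun i x => (hr i).ne_bot _
  exact (continuous_coe_real_ereal.comp hΦ).lowerSemicontinuous.add' hR fun x =>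
    EReal.continuousAt_add (Or.inl (EReal.coe_ne_top _)) (Or.inl (EReal.coe_ne_bot _))

theorem convexOn_blockObj {L : (i : Fin d) → Matrix (Fin (m i)) (Fin (m i)) ℝ}
    (hφ : ∀ i, IsConvexSmooth (φ i) (L i)) (hr : ∀ i, IsProperConvexLsc (r i)) (i : Fin d) :
    ConvexOn ℝ {u | r i u ≠ ⊤} (blockObj φ r i) :=
  ((hφ i).convexOn.subset (Set.subset_univ _) (hr i).convexOn.1).add (hr i).convexOn

/-- What the analysis uses of a solution `x`, given a dual solution `y`. -/
structure IsReference (φ : (i : Fin d) → EuclideanSpace ℝ (Fin (m i)) → ℝ)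
    (r : (i : Fin d) → EuclideanSpace ℝ (Fin (m i)) → EReal)
    (A : Matrix (Fin q) ((i : Fin d) × Fin (m i)) ℝ) (b : EuclideanSpace ℝ (Fin q))
    (y x : BlockVec m) : Prop where
  dom : x ∈ objDom r
  normal : Matrix.toEuclideanLin A.transpose (Matrix.toEuclideanLin A x - b) = 0
  saddle : ∀ u ∈ objDom r, realObj φ r x +
    inner ℝ (Matrix.toEuclideanLin A y) (Matrix.toEuclideanLin A (u - x)) ≤ realObj φ r u

variable {A : Matrix (Fin q) ((i : Fin d) × Fin (m i)) ℝ} {b : EuclideanSpace ℝ (Fin q)}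

theorem IsSaddlePoint.isReference (hr : ∀ i, IsProperConvexLsc (r i)) {x y : BlockVec m}
    (h : IsSaddlePoint φ r A b x y) : IsReference φ r A b y x where
  dom := mem_objDom_of_Psi_ne_top hr h.1.1
  normal := normal_of_saddle h.2
  saddle u hu := by
    have := h.1.2 u
    rw [Psi_eq_realObj hr hu, Psi_eq_realObj hr (mem_objDom_of_Psi_ne_top hr h.1.1),
      toEuclideanLin_mul, inner_toEuclideanLin_transpose] at this
    exact_mod_cast this

theorem IsReference.mem_solutions (hr : ∀ i, IsProperConvexLsc (r i)) {x y : BlockVec m}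
    (h : IsReference φ r A b y x) : x ∈ solutions φ r A b := by
  refine ⟨mem_feasible_of_normal h.normal, fun u hu => ?_⟩
  by_cases hut : Psi φ r u = ⊤
  · rw [hut]; exact le_top
  · have hud := mem_objDom_of_Psi_ne_top hr hut
    have := h.saddle u hud
    rw [map_sub, (mem_feasible_iff_of_normal h.normal).1 hu, sub_self, inner_zero_right] at this
    rw [Psi_eq_realObj hr hud, Psi_eq_realObj hr h.dom]
    exact_mod_cast (by linarith)

/-- All solutions share the value of Ψ and the image under `A`, and the saddle inequality sees only
these. One dual vector `y` therefore serves every solution. -/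
theorem IsReference.of_mem_solutions (hr : ∀ i, IsProperConvexLsc (r i)) {x y u : BlockVec m}
    (h : IsReference φ r A b y x) (hu : u ∈ solutions φ r A b) : IsReference φ r A b y u := by
  have hx := h.mem_solutions hr
  have hle : Psi φ r u ≤ Psi φ r x := hu.2 x hx.1
  have hA : Matrix.toEuclideanLin A u = Matrix.toEuclideanLin A x :=
    (mem_feasible_iff_of_normal h.normal).1 hu.1
  rw [Psi_eq_realObj hr h.dom] at hle
  have hud : u ∈ objDom r :=
    mem_objDom_of_Psi_ne_top hr (ne_top_of_le_ne_top (EReal.coe_ne_top _) hle)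
  rw [Psi_eq_realObj hr hud] at hle
  have hle' : realObj φ r u ≤ realObj φ r x := by exact_mod_cast hle
  refine ⟨hud, by rw [hA, h.normal], fun v hv => ?_⟩
  have := h.saddle v hv
  rw [map_sub] at this ⊢
  rw [hA]
  linarith

theorem IsReference.mem_solutions_of_le (hr : ∀ i, IsProperConvexLsc (r i)) {x y u : BlockVec m}
    (h : IsReference φ r A b y x)
    (hA : Matrix.toEuclideanLin A u = Matrix.toEuclideanLin A x)
    (hle : Psi φ r u ≤ (realObj φ r x : ℝ)) : u ∈ solutions φ r A b := by
  refine ⟨(mem_feasible_iff_of_normal h.normal).2 hA, fun v hv => hle.trans ?_⟩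
  rw [← Psi_eq_realObj hr h.dom]
  exact (h.mem_solutions hr).2 v hv

end Objective

/-- The data of the algorithm with constant step parameters, and its standing assumptions in
quadratic-form shape; `ν` is the law of the sampling. -/
structure Setup {d : ℕ} (m : Fin d → ℕ) (q : ℕ) where
  φ : (i : Fin d) → EuclideanSpace ℝ (Fin (m i)) → ℝ
  r : (i : Fin d) → EuclideanSpace ℝ (Fin (m i)) → EReal
  A : Matrix (Fin q) ((i : Fin d) × Fin (m i)) ℝ
  b : EuclideanSpace ℝ (Fin q)
  L : (i : Fin d) → Matrix (Fin (m i)) (Fin (m i)) ℝ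
  B : (i : Fin d) → Matrix (Fin (m i)) (Fin (m i)) ℝ
  hL : ∀ i, (L i).PosDef
  hB : ∀ i, (B i).PosDef
  hφ : ∀ i, IsConvexSmooth (φ i) (L i)
  hr : ∀ i, IsProperConvexLsc (r i)
  ν : Measure (Finset (Fin d))
  prob : IsProbabilityMeasure ν
  p : Fin d → ℝ
  p_eq : ∀ i, p i = ν.real {J | i ∈ J}
  p_pos : ∀ i, 0 < p i
  σ : ℝ
  σ_pos : 0 < σ
  σ_le_p : ∀ i, σ ≤ p i
  σ_le_one : σ ≤ 1
  moment : ∀ v : BlockVec m, σ * ∫ J, ‖Matrix.toEuclideanLin A (Matrix.toEuclideanLin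
      (weightMat m p) (Matrix.toEuclideanLin (activation m J) v))‖ ^ 2 ∂ν +
    ∑ i, sqNorm (L i) (block v i) ≤ ∑ i, 1 / p i * sqNorm (B i) (block v i)
  x0 : BlockVec m
  x0_dom : x0 ∈ objDom r

/-! ### The iterates, and w^k as an average of the past x^j. -/

namespace Setup

variable {d q : ℕ} {m : Fin d → ℕ} (P : Setup m q)

instance : IsProbabilityMeasure P.ν := P.prob

theorem p_le_one (i : Fin d) : P.p i ≤ 1 := by
  rw [P.p_eq]; exact measureReal_le_one

/-- The iterates `x^k`. -/
def X (k : ℕ) (J : ℕ → Finset (Fin d)) : BlockVec m :=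
  (iterates P.φ P.r P.A P.b P.B P.p (fun _ => P.σ) (fun _ => 1) P.x0 J k).1

/-- The iterates `w^k`. -/
def W (k : ℕ) (J : ℕ → Finset (Fin d)) : BlockVec m :=
  (iterates P.φ P.r P.A P.b P.B P.p (fun _ => P.σ) (fun _ => 1) P.x0 J k).2

/-- The points `z^k`. -/
def Z (k : ℕ) (J : ℕ → Finset (Fin d)) : BlockVec m :=
  zPoint (fun _ => P.σ) k (P.X k J) (P.W k J)

/-- The point `x^{k+1}` would be if all the blocks were updated. -/
def fullStep (k : ℕ) (J : ℕ → Finset (Fin d)) : BlockVec m :=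
  xUpdate P.φ P.r P.A P.b P.B P.p (fun _ => P.σ) (fun _ => 1) k Finset.univ (P.X k J) (P.W k J)

/-- The weight `S_{k-1}`. -/
def s (k : ℕ) : ℝ := 1 - P.σ + k * P.σ

theorem s_nonneg (k : ℕ) : 0 ≤ P.s k := by
  have := P.σ_le_one
  have := P.σ_pos
  unfold s
  have : 0 ≤ (k : ℝ) * P.σ := by positivity
  linarith

theorem s_succ (k : ℕ) : P.s (k + 1) = P.s k + P.σ := by
  unfold s; push_cast; ring

theorem s_succ_pos (k : ℕ) : 0 < P.s (k + 1) := by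
  rw [s_succ]
  have := P.s_nonneg k
  have := P.σ_pos
  linarith

theorem S_eq (k : ℕ) : S (fun _ => P.σ) k = P.s (k + 1) := by
  simp only [S, s, Finset.sum_const, Nat.card_Icc]
  simp
  ring

theorem X_zero (J : ℕ → Finset (Fin d)) : P.X 0 J = P.x0 := rfl

theorem W_zero (J : ℕ → Finset (Fin d)) : P.W 0 J = P.x0 := rfl

theorem X_succ (k : ℕ) (J : ℕ → Finset (Fin d)) : P.X (k + 1) J =
    xUpdate P.φ P.r P.A P.b P.B P.p (fun _ => P.σ) (fun _ => 1) k (J k) (P.X k J) (P.W k J) := rfl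

theorem W_succ (k : ℕ) (J : ℕ → Finset (Fin d)) : P.W (k + 1) J =
    P.Z k J + theta (fun _ => P.σ) k •
      Matrix.toEuclideanLin (weightMat m P.p) (P.X (k + 1) J - P.X k J) := rfl

theorem block_X_succ (k : ℕ) (J : ℕ → Finset (Fin d)) (i : Fin d) :
    block (P.X (k + 1) J) i =
      if i ∈ J k then block (P.fullStep k J) i else block (P.X k J) i := by
  rw [X_succ, fullStep, xUpdate, xUpdate, block_ofBlocks, block_ofBlocks]
  simp

theorem iterates_dependsOnPast (k : ℕ) : DependsOnPast k (iterates P.φ P.r P.A P.b P.B P.p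
    (fun _ => P.σ) (fun _ => 1) P.x0 · k) := by
  induction k with
  | zero => intro J J' _; rfl
  | succ k ih =>
    intro J J' h
    have h1 := ih J J' fun j hj => h j (by omega)
    have h2 := h k (by omega)
    simp only at h1
    simp only [iterates, h1, h2]

theorem X_dependsOnPast {k l : ℕ} (h : k ≤ l) : DependsOnPast l (P.X k) := fun J J' hJ => by
  exact congrArg Prod.fst (P.iterates_dependsOnPast k J J' fun j hj => hJ j (by omega))

theorem W_dependsOnPast {k l : ℕ} (h : k ≤ l) : DependsOnPast l (P.W k) := fun J J' hJ => by
  exact congrArg Prod.snd (P.iterates_dependsOnPast k J J' fun j hj => hJ j (by omega))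

theorem fullStep_dependsOnPast {k l : ℕ} (h : k ≤ l) : DependsOnPast l (P.fullStep k) :=
  fun J J' hJ => by
    unfold fullStep
    rw [P.X_dependsOnPast h J J' hJ, P.W_dependsOnPast h J J' hJ]

theorem s_smul_Z (k : ℕ) (J : ℕ → Finset (Fin d)) :
    P.s (k + 1) • P.Z k J = P.s k • P.W k J + P.σ • P.X k J := by
  have h := (P.s_succ_pos k).ne'
  simp only [Z, zPoint, theta, S_eq, smul_add, smul_smul]
  congr 2
  · rw [s_succ] at *
    field_simp; ring
  · field_simp

theorem s_smul_W_succ (k : ℕ) (J : ℕ → Finset (Fin d)) :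
    P.s (k + 1) • P.W (k + 1) J = P.s k • P.W k J + P.σ • P.X k J +
      P.σ • Matrix.toEuclideanLin (weightMat m P.p) (P.X (k + 1) J - P.X k J) := by
  have h := (P.s_succ_pos k).ne'
  rw [W_succ, smul_add, s_smul_Z, theta, S_eq, smul_smul, mul_div_cancel₀ _ h]

/-- The recursion for s_k w^k summed over time; the weighted increments of x telescope. -/
theorem s_smul_block_W (k : ℕ) (J : ℕ → Finset (Fin d)) (i : Fin d) :
    P.s k • block (P.W k J) i = P.σ • ∑ j ∈ Finset.range k, block (P.X j J) i +
      (P.σ / P.p i) • (block (P.X k J) i - block P.x0 i) + (1 - P.σ) • block P.x0 i := by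
  induction k with
  | zero => simp [X_zero, W_zero, s]
  | succ k ih =>
    have h := congrArg (fun v => block v i) (P.s_smul_W_succ k J)
    simp only [block_add, block_smul, block_weightMat, block_sub] at h
    rw [h, ih, Finset.sum_range_succ]
    module

theorem posDef_scaled (i : Fin d) : ((1 / (P.p i * 1)) • P.B i).PosDef :=
  (P.hB i).smul (by have := P.p_pos i; positivity)

theorem block_fullStep (k : ℕ) (J : ℕ → Finset (Fin d)) (i : Fin d) :
    block (P.fullStep k J) i = forwardBackward (P.r i) ((1 / (P.p i * 1)) • P.B i)
        (gradient (P.φ i) (block (P.X k J) i) +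
          P.s (k + 1) • block (gradient (penalty P.A P.b) (P.Z k J)) i) (block (P.X k J) i) := by
  rw [fullStep, xUpdate, block_ofBlocks, if_pos (Finset.mem_univ i), S_eq]
  rfl

theorem fullStep_dom (k : ℕ) (J : ℕ → Finset (Fin d)) : P.fullStep k J ∈ objDom P.r := fun i => by
  rw [block_fullStep]
  exact forwardBackward_ne_top (P.hr i) (P.posDef_scaled i) _ _

theorem X_dom (k : ℕ) (J : ℕ → Finset (Fin d)) : P.X k J ∈ objDom P.r := by
  induction k with
  | zero => exact P.x0_dom
  | succ k ih =>
    intro i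
    rw [block_X_succ]
    split_ifs
    · exact P.fullStep_dom k J i
    · exact ih i

/-- The surrogate of `S_{k-1} ψ_i(w^k_i)`. -/
def surrogate (k : ℕ) (J : ℕ → Finset (Fin d)) (i : Fin d) : ℝ :=
  P.σ * ∑ j ∈ Finset.range k, blockObj P.φ P.r i (block (P.X j J) i) +
    P.σ / P.p i * (blockObj P.φ P.r i (block (P.X k J) i) - blockObj P.φ P.r i (block P.x0 i)) +
    (1 - P.σ) * blockObj P.φ P.r i (block P.x0 i)

/-- `w^k_i` is a convex combination of `x^0_i, …, x^k_i`. -/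
theorem block_W_convex (k : ℕ) (J : ℕ → Finset (Fin d)) (i : Fin d) :
    P.r i (block (P.W k J) i) ≠ ⊤ ∧
      P.s k * blockObj P.φ P.r i (block (P.W k J) i) ≤ P.surrogate k J i := by
  have hconv := convexOn_blockObj P.hφ P.hr i
  -- Time zero is separate: s_0 = 1 - σ may vanish, so the weights cannot be normalised, but the two
  -- sides agree.
  rcases k with _ | k
  · refine ⟨P.x0_dom i, ?_⟩
    simp [surrogate, X_zero, W_zero, s]
  · have hs := P.s_succ_pos k
    have hp := P.p_pos i
    have hσ := P.σ_pos
    have hσp : P.σ / P.p i ≤ 1 := (div_le_one hp).2 (P.σ_le_p i)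
    -- The collected coefficients of `s_smul_block_W` at time k + 1. That of x^0 is σ + (1 - σ) -
    -- σ/π_i, nonnegative because σ ≤ π_i.
    set c : ℕ → ℝ := fun j => if j = 0 then 1 - P.σ / P.p i else
      if j = k + 1 then P.σ / P.p i else P.σ with hc
    have hc0 : ∀ j ∈ Finset.range (k + 2), 0 ≤ c j / P.s (k + 1) := by
      intro j _
      refine div_nonneg ?_ hs.le
      simp only [hc]
      split_ifs
      · linarith
      · positivity
      · exact hσ.le
    -- Stated for a general module because it is applied to the points, to the values of ψ_i, and to
    -- the constant one (total mass).
    have hsum : ∀ {M : Type} [AddCommGroup M] [Module ℝ M] (f : ℕ → M),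
        ∑ j ∈ Finset.range (k + 2), c j • f j = P.σ • ∑ j ∈ Finset.range (k + 1), f j +
          (P.σ / P.p i) • (f (k + 1) - f 0) + (1 - P.σ) • f 0 := by
      intro M _ _ f
      rw [Finset.sum_range_succ, Finset.sum_range_succ', Finset.sum_range_succ' (fun j => f j)]
      have h1 : ∀ j ∈ Finset.range k, c (j + 1) • f (j + 1) = P.σ • f (j + 1) := by
        intro j hj
        have : j ≠ k := (Finset.mem_range.1 hj).ne
        simp [hc, this]
      rw [Finset.sum_congr rfl h1, ← Finset.smul_sum]
      simp only [hc, if_pos, Nat.succ_ne_zero, if_false]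
      module
    have hdiv : ∀ {M : Type} [AddCommGroup M] [Module ℝ M] (f : ℕ → M),
        ∑ j ∈ Finset.range (k + 2), (c j / P.s (k + 1)) • f j =
          (P.s (k + 1))⁻¹ • ∑ j ∈ Finset.range (k + 2), c j • f j := by
      intro M _ _ f
      rw [Finset.smul_sum]
      refine Finset.sum_congr rfl fun j _ => ?_
      rw [smul_smul, div_eq_inv_mul]
    have hc1 : ∑ j ∈ Finset.range (k + 2), c j / P.s (k + 1) = 1 := by
      have h1 := hdiv fun _ => (1 : ℝ)
      have h2 := hsum fun _ => (1 : ℝ)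
      simp only [smul_eq_mul, mul_one] at h1 h2
      rw [h1, h2, inv_mul_eq_one₀ hs.ne']
      simp [s]
      ring
    have hmem : ∀ j ∈ Finset.range (k + 2),
        block (P.X j J) i ∈ {u | P.r i u ≠ ⊤} := fun j _ => P.X_dom j J i
    have hW : block (P.W (k + 1) J) i =
        ∑ j ∈ Finset.range (k + 2), (c j / P.s (k + 1)) • block (P.X j J) i := by
      rw [hdiv, hsum, X_zero, ← s_smul_block_W, smul_smul, inv_mul_cancel₀ hs.ne', one_smul]
    constructor
    · rw [hW]
      exact hconv.1.sum_mem hc0 hc1 hmem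
    · have h := hconv.map_sum_le hc0 hc1 hmem
      rw [← hW, hdiv, hsum, smul_eq_mul, inv_mul_eq_div, le_div_iff₀ hs] at h
      simp only [smul_eq_mul, X_zero] at h
      unfold surrogate
      linarith

theorem W_dom (k : ℕ) (J : ℕ → Finset (Fin d)) : P.W k J ∈ objDom P.r :=
  fun i => (P.block_W_convex k J i).1

theorem s_mul_realObj_W_le (k : ℕ) (J : ℕ → Finset (Fin d)) :
    P.s k * realObj P.φ P.r (P.W k J) ≤ ∑ i, P.surrogate k J i := by
  rw [realObj, Finset.mul_sum]
  exact Finset.sum_le_sum fun i _ => (P.block_W_convex k J i).2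

/-! ### The Lyapunov function and its expected decrease. -/

variable {P} {y xs : BlockVec m} (h : IsReference P.φ P.r P.A P.b y xs)

/-- The dual variable generated by the algorithm: `S_k A (z^k - x*)`. -/
def dualVar (P : Setup m q) (xs : BlockVec m) (k : ℕ) (J : ℕ → Finset (Fin d)) :
    EuclideanSpace ℝ (Fin q) :=
  Matrix.toEuclideanLin P.A (P.s k • (P.W k J - xs) + P.σ • (P.X k J - xs))

/-- Links the two roles of this vector: it is what the gradient step sees, S_k∇h(z^k) being its
image under Aᵀ, and it is the predictable part of the next residual s_{k+1}A(w^{k+1} - x*). -/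
theorem dualVar_eq (P : Setup m q) (xs : BlockVec m) (k : ℕ) (J : ℕ → Finset (Fin d)) :
    P.dualVar xs k J = P.s (k + 1) • Matrix.toEuclideanLin P.A (P.Z k J - xs) := by
  rw [dualVar, ← map_smul, smul_sub (P.s (k + 1)), s_smul_Z, s_succ]
  congr 1
  module

include h in
/-- The forward-backward step seen from a solution. -/
theorem fullStep_inequality (k : ℕ) (J : ℕ → Finset (Fin d)) :
    realObj P.φ P.r (P.fullStep k J) - realObj P.φ P.r xs +
      inner ℝ (P.dualVar xs k J) (Matrix.toEuclideanLin P.A (P.fullStep k J - xs)) -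
      ∑ i, bregman (P.φ i) (block (P.fullStep k J) i) (block (P.X k J) i) +
      ∑ i, bregman (P.φ i) (block xs i) (block (P.X k J) i) ≤
    1 / 2 * ∑ i, 1 / P.p i * (sqNorm (P.B i) (block xs i - block (P.X k J) i) -
      sqNorm (P.B i) (block xs i - block (P.fullStep k J) i) -
      sqNorm (P.B i) (block (P.fullStep k J) i - block (P.X k J) i)) := by
  have key : ∀ i, blockObj P.φ P.r i (block (P.fullStep k J) i) - blockObj P.φ P.r i (block xs i) +
      inner ℝ (block (P.s (k + 1) • gradient (penalty P.A P.b) (P.Z k J)) i)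
        (block (P.fullStep k J - xs) i) -
      bregman (P.φ i) (block (P.fullStep k J) i) (block (P.X k J) i) +
      bregman (P.φ i) (block xs i) (block (P.X k J) i) ≤
    1 / 2 * (1 / P.p i * (sqNorm (P.B i) (block xs i - block (P.X k J) i) -
      sqNorm (P.B i) (block xs i - block (P.fullStep k J) i) -
      sqNorm (P.B i) (block (P.fullStep k J) i - block (P.X k J) i))) := by
    intro i
    have h1 := forwardBackward_three_point (P.hr i) (P.posDef_scaled i)
      (gradient (P.φ i) (block (P.X k J) i) +
          P.s (k + 1) • block (gradient (penalty P.A P.b) (P.Z k J)) i) (block (P.X k J) i)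
      (h.dom i)
    rw [← block_fullStep, inner_add_left, bregman_sub_bregman] at h1
    simp only [sqNorm_smul_matrix, mul_one] at h1
    simp only [blockObj, block_sub, block_smul]
    linarith
  have hsum := Finset.sum_le_sum fun i (_ : i ∈ Finset.univ) => key i
  simp only [Finset.sum_add_distrib, Finset.sum_sub_distrib, ← Finset.mul_sum] at hsum
  rw [← inner_eq_sum_block, gradient_penalty_of_normal h.normal, inner_smul_left,
    inner_toEuclideanLin_transpose] at hsum
  rw [dualVar_eq, inner_smul_left]
  simp only [realObj]
  simpa using hsum

/-- The Lyapunov function. -/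
def lyapunov (P : Setup m q) (y xs : BlockVec m) (k : ℕ) (J : ℕ → Finset (Fin d)) : ℝ :=
  ∑ i, P.surrogate k J i - P.s k * realObj P.φ P.r xs +
    1 / 2 * ‖Matrix.toEuclideanLin P.A (P.s k • (P.W k J - xs))‖ ^ 2 +
    1 / 2 * ‖Matrix.toEuclideanLin P.A y‖ ^ 2 +
    P.σ / 2 * ∑ i, 1 / P.p i ^ 2 * sqNorm (P.B i) (block xs i - block (P.X k J) i)

/-- The Bregman distances of a reference point to `x^k`. -/
def refGap (P : Setup m q) (xs : BlockVec m) (k : ℕ) (J : ℕ → Finset (Fin d)) : ℝ :=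
  ∑ i, bregman (P.φ i) (block xs i) (block (P.X k J) i)

/-- The slack in the descent inequality. -/
def slack (P : Setup m q) (k : ℕ) (J : ℕ → Finset (Fin d)) : ℝ :=
  ∑ i, (1 / 2 * sqNorm (P.L i) (block (P.fullStep k J) i - block (P.X k J) i) -
    bregman (P.φ i) (block (P.fullStep k J) i) (block (P.X k J) i))

/-- The guaranteed expected decrease of the Lyapunov function. -/
def decrease (P : Setup m q) (xs : BlockVec m) (k : ℕ) (J : ℕ → Finset (Fin d)) : ℝ :=
  P.σ ^ 2 / 2 * ‖Matrix.toEuclideanLin P.A (P.X k J - xs)‖ ^ 2 + P.σ * P.slack k J +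
    P.σ * P.refGap xs k J

theorem refGap_nonneg (P : Setup m q) (xs : BlockVec m) (k : ℕ) (J : ℕ → Finset (Fin d)) :
    0 ≤ P.refGap xs k J :=
  Finset.sum_nonneg fun i _ => (P.hφ i).bregman_nonneg _ _

theorem slack_nonneg (P : Setup m q) (k : ℕ) (J : ℕ → Finset (Fin d)) : 0 ≤ P.slack k J :=
  Finset.sum_nonneg fun i _ => sub_nonneg.2 ((P.hφ i).bregman_le _ _)

theorem decrease_nonneg (P : Setup m q) (xs : BlockVec m) (k : ℕ) (J : ℕ → Finset (Fin d)) :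
    0 ≤ P.decrease xs k J := by
  have := P.refGap_nonneg xs k J
  have := P.slack_nonneg k J
  have := P.σ_pos
  unfold decrease
  positivity

include h in
theorem lyapunov_lower_bound (k : ℕ) (J : ℕ → Finset (Fin d)) :
    0 ≤ ∑ i, P.surrogate k J i - P.s k * realObj P.φ P.r xs -
      inner ℝ (Matrix.toEuclideanLin P.A y)
        (Matrix.toEuclideanLin P.A (P.s k • (P.W k J - xs))) := by
  have h1 := P.s_mul_realObj_W_le k J
  have h2 := mul_le_mul_of_nonneg_left (h.saddle _ (P.W_dom k J)) (P.s_nonneg k)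
  rw [map_smul, inner_smul_right]
  linarith

/-- Completing the square in the residual exhibits three nonnegative summands, the first by
`lyapunov_lower_bound`. The constant ½‖Ay‖² was put into the Lyapunov function for this purpose. -/
theorem lyapunov_eq (P : Setup m q) (y xs : BlockVec m) (k : ℕ) (J : ℕ → Finset (Fin d)) :
    P.lyapunov y xs k J =
      (∑ i, P.surrogate k J i - P.s k * realObj P.φ P.r xs -
        inner ℝ (Matrix.toEuclideanLin P.A y)
          (Matrix.toEuclideanLin P.A (P.s k • (P.W k J - xs)))) +
      1 / 2 * ‖Matrix.toEuclideanLin P.A y +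
        Matrix.toEuclideanLin P.A (P.s k • (P.W k J - xs))‖ ^ 2 +
      P.σ / 2 * ∑ i, 1 / P.p i ^ 2 * sqNorm (P.B i) (block xs i - block (P.X k J) i) := by
  rw [lyapunov, norm_add_sq_real]
  ring

theorem weighted_dist_nonneg (P : Setup m q) (xs : BlockVec m) (k : ℕ)
    (J : ℕ → Finset (Fin d)) :
    0 ≤ P.σ / 2 * ∑ i, 1 / P.p i ^ 2 * sqNorm (P.B i) (block xs i - block (P.X k J) i) := by
  have := P.σ_pos
  refine mul_nonneg (by positivity) (Finset.sum_nonneg fun i _ => mul_nonneg (by positivity)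
    (sqNorm_nonneg (P.hB i) _))

include h in
theorem lyapunov_nonneg (k : ℕ) (J : ℕ → Finset (Fin d)) : 0 ≤ P.lyapunov y xs k J := by
  rw [lyapunov_eq]
  have h1 := lyapunov_lower_bound h k J
  have h2 := P.weighted_dist_nonneg xs k J
  positivity

theorem integral_sum_ite (P : Setup m q) (c : Fin d → ℝ) :
    ∫ a, ∑ i, (if i ∈ a then c i else 0) ∂P.ν = ∑ i, P.p i * c i := by
  rw [integral_finsetSum _ fun _ _ => Integrable.of_finite]
  refine Finset.sum_congr rfl fun i _ => ?_
  have : (fun a : Finset (Fin d) => if i ∈ a then c i else 0) =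
      {a : Finset (Fin d) | i ∈ a}.indicator fun _ => c i := by
    funext a; simp [Set.indicator]
  rw [this, integral_indicator_const _ (MeasurableSet.of_discrete), ← P.p_eq, smul_eq_mul]

theorem block_X_succ_update (P : Setup m q) (k : ℕ) (J : ℕ → Finset (Fin d))
    (a : Finset (Fin d)) (i : Fin d) :
    block (P.X (k + 1) (Function.update J k a)) i =
      if i ∈ a then block (P.fullStep k J) i else block (P.X k J) i := by
  rw [block_X_succ, Function.update_self, (P.fullStep_dependsOnPast le_rfl).update,
    (P.X_dependsOnPast le_rfl).update]

theorem X_succ_update_sub (P : Setup m q) (k : ℕ) (J : ℕ → Finset (Fin d))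
    (a : Finset (Fin d)) :
    P.X (k + 1) (Function.update J k a) - P.X k J =
      Matrix.toEuclideanLin (activation m a) (P.fullStep k J - P.X k J) := by
  refine block_ext fun i => ?_
  rw [block_sub, block_X_succ_update, block_activation, block_sub]
  split_ifs <;> simp

theorem surrogate_succ_update (P : Setup m q) (k : ℕ) (J : ℕ → Finset (Fin d))
    (a : Finset (Fin d)) (i : Fin d) :
    P.surrogate (k + 1) (Function.update J k a) i = P.surrogate k J i +
      P.σ * blockObj P.φ P.r i (block (P.X k J) i) +
      (if i ∈ a then P.σ / P.p i * (blockObj P.φ P.r i (block (P.fullStep k J) i) -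
        blockObj P.φ P.r i (block (P.X k J) i)) else 0) := by
  have h1 : ∀ j ∈ Finset.range (k + 1), blockObj P.φ P.r i
      (block (P.X j (Function.update J k a)) i) = blockObj P.φ P.r i (block (P.X j J) i) := by
    intro j hj
    rw [(P.X_dependsOnPast (Nat.lt_succ_iff.1 (Finset.mem_range.1 hj))).update]
  rw [surrogate, surrogate, Finset.sum_congr rfl h1, Finset.sum_range_succ, block_X_succ_update]
  split_ifs <;> ring

theorem s_smul_W_succ_update (P : Setup m q) (xs : BlockVec m) (k : ℕ)
    (J : ℕ → Finset (Fin d)) (a : Finset (Fin d)) :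
    Matrix.toEuclideanLin P.A (P.s (k + 1) • (P.W (k + 1) (Function.update J k a) - xs)) =
      P.dualVar xs k J + P.σ • Matrix.toEuclideanLin P.A (Matrix.toEuclideanLin (weightMat m P.p)
        (Matrix.toEuclideanLin (activation m a) (P.fullStep k J - P.X k J))) := by
  rw [smul_sub, s_smul_W_succ, (P.W_dependsOnPast le_rfl).update,
    (P.X_dependsOnPast le_rfl).update, X_succ_update_sub, dualVar, s_succ]
  simp only [map_add, map_sub, map_smul]
  module

theorem inner_weighted_step (P : Setup m q) (k : ℕ) (J : ℕ → Finset (Fin d))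
    (a : Finset (Fin d)) (u : EuclideanSpace ℝ (Fin q)) :
    inner ℝ u (Matrix.toEuclideanLin P.A (Matrix.toEuclideanLin (weightMat m P.p)
        (Matrix.toEuclideanLin (activation m a) (P.fullStep k J - P.X k J)))) =
      ∑ i, if i ∈ a then 1 / P.p i * inner ℝ (block (Matrix.toEuclideanLin P.A.transpose u) i)
        (block (P.fullStep k J - P.X k J) i) else 0 := by
  rw [← inner_toEuclideanLin_transpose, inner_eq_sum_block]
  refine Finset.sum_congr rfl fun i _ => ?_
  rw [block_weightMat, block_activation, inner_smul_right]
  split_ifs <;> simp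

/-- Separates the part known at time k from the randomness of the new sample `a`. The latter is a
sum over selected blocks, integrated by `integral_sum_ite`, and one square, controlled by `moment`.
-/
theorem lyapunov_succ_update (P : Setup m q) (y xs : BlockVec m) (k : ℕ)
    (J : ℕ → Finset (Fin d)) (a : Finset (Fin d)) :
    P.lyapunov y xs (k + 1) (Function.update J k a) =
      (∑ i, P.surrogate k J i + P.σ * realObj P.φ P.r (P.X k J) -
        P.s (k + 1) * realObj P.φ P.r xs + 1 / 2 * ‖P.dualVar xs k J‖ ^ 2 +
        1 / 2 * ‖Matrix.toEuclideanLin P.A y‖ ^ 2 +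
        P.σ / 2 * ∑ i, 1 / P.p i ^ 2 * sqNorm (P.B i) (block xs i - block (P.X k J) i)) +
      (∑ i, if i ∈ a then
        P.σ / P.p i * (blockObj P.φ P.r i (block (P.fullStep k J) i) -
          blockObj P.φ P.r i (block (P.X k J) i)) +
        P.σ * (1 / P.p i * inner ℝ
          (block (Matrix.toEuclideanLin P.A.transpose (P.dualVar xs k J)) i)
          (block (P.fullStep k J - P.X k J) i)) +
        P.σ / 2 * (1 / P.p i ^ 2 * (sqNorm (P.B i) (block xs i - block (P.fullStep k J) i) -
          sqNorm (P.B i) (block xs i - block (P.X k J) i))) else 0) +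
      P.σ ^ 2 / 2 * ‖Matrix.toEuclideanLin P.A (Matrix.toEuclideanLin (weightMat m P.p)
        (Matrix.toEuclideanLin (activation m a) (P.fullStep k J - P.X k J)))‖ ^ 2 := by
  have hdist : ∀ i, 1 / P.p i ^ 2 *
      sqNorm (P.B i) (block xs i - block (P.X (k + 1) (Function.update J k a)) i) =
      1 / P.p i ^ 2 * sqNorm (P.B i) (block xs i - block (P.X k J) i) +
      if i ∈ a then 1 / P.p i ^ 2 * (sqNorm (P.B i) (block xs i - block (P.fullStep k J) i) -
          sqNorm (P.B i) (block xs i - block (P.X k J) i)) else 0 := by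
    intro i
    rw [block_X_succ_update]
    split_ifs <;> ring
  have hsplit : ∀ f g l : Fin d → ℝ, (∑ i, if i ∈ a then f i + P.σ * g i + P.σ / 2 * l i else 0) =
      (∑ i, if i ∈ a then f i else 0) + P.σ * (∑ i, if i ∈ a then g i else 0) +
        P.σ / 2 * (∑ i, if i ∈ a then l i else 0) := by
    intro f g l
    rw [Finset.mul_sum, Finset.mul_sum, ← Finset.sum_add_distrib, ← Finset.sum_add_distrib]
    refine Finset.sum_congr rfl fun i _ => ?_
    split_ifs <;> simp
  rw [hsplit, ← inner_weighted_step, lyapunov, s_smul_W_succ_update, norm_add_sq_real,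
    inner_smul_right, norm_smul, mul_pow, Real.norm_eq_abs, sq_abs]
  simp only [surrogate_succ_update, hdist, Finset.sum_add_distrib, ← Finset.mul_sum, realObj]
  ring

include h in
/-- The Lyapunov function decreases in conditional expectation. -/
theorem integral_lyapunov_le (k : ℕ) (J : ℕ → Finset (Fin d)) :
    ∫ a, P.lyapunov y xs (k + 1) (Function.update J k a) ∂P.ν + P.decrease xs k J ≤
      P.lyapunov y xs k J := by
  simp only [lyapunov_succ_update]
  rw [integral_add Integrable.of_finite Integrable.of_finite,
    integral_add Integrable.of_finite Integrable.of_finite, integral_sum_ite, integral_const,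
    probReal_univ, one_smul, integral_const_mul]
  have hfull := fullStep_inequality h k J
  have hmom := P.moment (P.fullStep k J - P.X k J)
  set M := ∫ a, ‖Matrix.toEuclideanLin P.A (Matrix.toEuclideanLin (weightMat m P.p)
    (Matrix.toEuclideanLin (activation m a) (P.fullStep k J - P.X k J)))‖ ^ 2 ∂P.ν with hM
  -- The activation probability cancels one factor 1/π_i, so the mean step is the full step; the
  -- distance carries 1/π_i² to retain the weight 1/π_i of the proximal metric.
  have hc : ∀ i, P.p i * (P.σ / P.p i * (blockObj P.φ P.r i (block (P.fullStep k J) i) -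
          blockObj P.φ P.r i (block (P.X k J) i)) +
        P.σ * (1 / P.p i * inner ℝ
          (block (Matrix.toEuclideanLin P.A.transpose (P.dualVar xs k J)) i)
          (block (P.fullStep k J - P.X k J) i)) +
        P.σ / 2 * (1 / P.p i ^ 2 * (sqNorm (P.B i) (block xs i - block (P.fullStep k J) i) -
          sqNorm (P.B i) (block xs i - block (P.X k J) i)))) =
      P.σ * (blockObj P.φ P.r i (block (P.fullStep k J) i) -
          blockObj P.φ P.r i (block (P.X k J) i)) +
      P.σ * inner ℝ (block (Matrix.toEuclideanLin P.A.transpose (P.dualVar xs k J)) i)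
          (block (P.fullStep k J - P.X k J) i) +
      P.σ / 2 * (1 / P.p i * (sqNorm (P.B i) (block xs i - block (P.fullStep k J) i) -
          sqNorm (P.B i) (block xs i - block (P.X k J) i))) := by
    intro i
    have := (P.p_pos i).ne'
    field_simp
  rw [Finset.sum_congr rfl fun i _ => hc i, Finset.sum_add_distrib, Finset.sum_add_distrib,
    ← Finset.mul_sum, ← Finset.mul_sum, ← Finset.mul_sum, ← inner_eq_sum_block,
    inner_toEuclideanLin_transpose]
  -- Expanding the square at time k around the dual variable leaves a surplus (σ²/2)‖A(x^k - x*)‖²,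
  -- the term that later drives A x^k to A x*.
  have hu : Matrix.toEuclideanLin P.A (P.s k • (P.W k J - xs)) =
      P.dualVar xs k J - P.σ • Matrix.toEuclideanLin P.A (P.X k J - xs) := by
    rw [dualVar, map_add, map_smul _ P.σ]; abel
  have hd : Matrix.toEuclideanLin P.A (P.fullStep k J - P.X k J) =
      Matrix.toEuclideanLin P.A (P.fullStep k J - xs) -
        Matrix.toEuclideanLin P.A (P.X k J - xs) := by
    rw [← map_sub]; congr 1; abel
  rw [lyapunov, decrease, hu, hd, norm_sub_sq_real, inner_smul_right, inner_sub_right, norm_smul,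
    mul_pow, Real.norm_eq_abs, sq_abs, s_succ, slack, refGap]
  simp only [block_sub] at hmom
  simp only [mul_sub, Finset.sum_sub_distrib, ← Finset.mul_sum] at hfull ⊢
  have hσ := P.σ_pos
  have h1 := mul_le_mul_of_nonneg_left hfull hσ.le
  have h2 := mul_le_mul_of_nonneg_left hmom hσ.le
  simp only [realObj] at h1 ⊢
  linarith

end Setup

/-! ### Almost sure properties of a realisation. -/

namespace Setup

variable {d q : ℕ} {m : Fin d → ℕ} {P : Setup m q} {y xs : BlockVec m}

theorem surrogate_dependsOnPast (P : Setup m q) (k : ℕ) (i : Fin d) :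
    DependsOnPast k fun J => P.surrogate k J i := fun J J' h => by
  have h1 : ∀ j ∈ Finset.range k, blockObj P.φ P.r i (block (P.X j J) i) =
      blockObj P.φ P.r i (block (P.X j J') i) := fun j hj => by
    rw [P.X_dependsOnPast (Finset.mem_range.1 hj).le J J' h]
  simp only [surrogate]
  rw [Finset.sum_congr rfl h1, P.X_dependsOnPast le_rfl J J' h]

theorem lyapunov_dependsOnPast (P : Setup m q) (y xs : BlockVec m) (k : ℕ) :
    DependsOnPast k (P.lyapunov y xs k) := fun J J' h => by
  unfold lyapunov
  rw [P.X_dependsOnPast le_rfl J J' h, P.W_dependsOnPast le_rfl J J' h,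
    Finset.sum_congr rfl fun i _ => P.surrogate_dependsOnPast k i J J' h]

theorem refGap_dependsOnPast (P : Setup m q) (xs : BlockVec m) (k : ℕ) :
    DependsOnPast k (P.refGap xs k) := fun J J' h => by
  unfold refGap
  rw [P.X_dependsOnPast le_rfl J J' h]

theorem decrease_dependsOnPast (P : Setup m q) (xs : BlockVec m) (k : ℕ) :
    DependsOnPast k (P.decrease xs k) := fun J J' h => by
  unfold decrease slack
  rw [P.refGap_dependsOnPast xs k J J' h, P.X_dependsOnPast le_rfl J J' h,
    P.fullStep_dependsOnPast le_rfl J J' h]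

/-- The weighted Bregman distances of a reference point to the full step. -/
def fullGap (P : Setup m q) (xs : BlockVec m) (k : ℕ) (J : ℕ → Finset (Fin d)) : ℝ :=
  P.σ * ∑ i, P.p i * bregman (P.φ i) (block xs i) (block (P.fullStep k J) i)

theorem fullGap_nonneg (P : Setup m q) (xs : BlockVec m) (k : ℕ) (J : ℕ → Finset (Fin d)) :
    0 ≤ P.fullGap xs k J :=
  mul_nonneg P.σ_pos.le (Finset.sum_nonneg fun i _ =>
    mul_nonneg (P.p_pos i).le ((P.hφ i).bregman_nonneg _ _))

theorem fullGap_dependsOnPast (P : Setup m q) (xs : BlockVec m) (k : ℕ) :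
    DependsOnPast k (P.fullGap xs k) := fun J J' h => by
  unfold fullGap
  rw [P.fullStep_dependsOnPast le_rfl J J' h]

/-- Block i moves to its full step with probability π_i and otherwise contributes a nonnegative
Bregman distance. -/
theorem fullGap_le_integral_refGap (P : Setup m q) (xs : BlockVec m) (k : ℕ)
    (J : ℕ → Finset (Fin d)) :
    P.fullGap xs k J ≤ P.σ * ∫ a, P.refGap xs (k + 1) (Function.update J k a) ∂P.ν := by
  refine mul_le_mul_of_nonneg_left ?_ P.σ_pos.le
  have : ∀ a, P.refGap xs (k + 1) (Function.update J k a) = P.refGap xs k J +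
      ∑ i, if i ∈ a then bregman (P.φ i) (block xs i) (block (P.fullStep k J) i) -
        bregman (P.φ i) (block xs i) (block (P.X k J) i) else 0 := by
    intro a
    rw [refGap, refGap, ← Finset.sum_add_distrib]
    refine Finset.sum_congr rfl fun i _ => ?_
    rw [block_X_succ_update]
    split_ifs <;> ring
  simp only [this]
  rw [integral_add Integrable.of_finite Integrable.of_finite, integral_sum_ite, integral_const,
    probReal_univ, one_smul, refGap, ← Finset.sum_add_distrib]
  refine Finset.sum_le_sum fun i _ => ?_
  have h1 := (P.hφ i).bregman_nonneg (block xs i) (block (P.X k J) i)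
  nlinarith [mul_nonneg (sub_nonneg.2 (P.p_le_one i)) h1]

/-- The almost sure properties of a realisation from which the convergence is deduced. -/
structure IsRegular (P : Setup m q) (y xs : BlockVec m) (J : ℕ → Finset (Fin d)) : Prop where
  lyapunov : ∃ l, Tendsto (fun k => P.lyapunov y xs k J) atTop (𝓝 l)
  decrease : Summable fun k => P.decrease xs k J
  fullGap : Summable fun k => P.fullGap xs k J

theorem ae_isRegular {Ω : Type*} [MeasurableSpace Ω] {μ : Measure Ω} [IsProbabilityMeasure μ]
    {ι : ℕ → Ω → Finset (Fin d)} (hι : ∀ k, Measurable (ι k)) (hind : iIndepFun ι μ)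
    (hν : ∀ k, μ.map (ι k) = P.ν) (h : IsReference P.φ P.r P.A P.b y xs) :
    ∀ᵐ ω ∂μ, P.IsRegular y xs fun j => ι j ω := by
  have h1 := ae_tendsto_and_summable hι hind hν (P.lyapunov_dependsOnPast y xs)
    (P.decrease_dependsOnPast xs) (lyapunov_nonneg h) (P.decrease_nonneg xs)
    (integral_lyapunov_le h)
  have hle : ∀ k J, P.σ * P.refGap xs k J ≤ P.decrease xs k J := fun k J => by
    have := P.slack_nonneg k J
    have := P.σ_pos
    rw [decrease]
    exact le_add_of_nonneg_left (by positivity)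
  -- Step control also needs the Bregman distances at the full step, absent from the decrease.
  -- Subtracting σ times the gap from V_k makes the gap at time k + 1 available. The result stays
  -- nonnegative since V_k dominates its decrease, which contains the gap at time k.
  have h2 := ae_tendsto_and_summable hι hind hν
    (F := fun k J => P.lyapunov y xs k J - P.σ * P.refGap xs k J) (δ := P.fullGap xs)
    (fun k J J' hJ => by
      simp only
      rw [P.lyapunov_dependsOnPast y xs k J J' hJ, P.refGap_dependsOnPast xs k J J' hJ])
    (P.fullGap_dependsOnPast xs)
    (fun k J => by
      have := integral_lyapunov_le h k J
      have : 0 ≤ ∫ a, P.lyapunov y xs (k + 1) (Function.update J k a) ∂P.ν :=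
        integral_nonneg fun a => lyapunov_nonneg h _ _
      linarith [hle k J])
    (P.fullGap_nonneg xs)
    (fun k J => by
      rw [integral_sub Integrable.of_finite Integrable.of_finite, integral_const_mul]
      linarith [integral_lyapunov_le h k J, hle k J, P.fullGap_le_integral_refGap xs k J])
  filter_upwards [h1, h2] with ω hω1 hω2
  exact ⟨hω1.1, hω1.2, hω2.2⟩

/-! ### Deterministic consequences along a regular realisation. -/

section Pathwise

variable {J : ℕ → Finset (Fin d)} (hJ : P.IsRegular y xs J)
  (h : IsReference P.φ P.r P.A P.b y xs)

include hJ in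
theorem IsRegular.exists_lyapunov_le : ∃ C, 0 ≤ C ∧ ∀ k, P.lyapunov y xs k J ≤ C := by
  obtain ⟨l, hl⟩ := hJ.lyapunov
  obtain ⟨C, hC⟩ := hl.bddAbove_range
  exact ⟨max C 0, le_max_right _ _, fun k => (hC ⟨k, rfl⟩).trans (le_max_left _ _)⟩

include hJ h in
theorem IsRegular.exists_residual_le :
    ∃ C, 0 ≤ C ∧ ∀ k, ‖Matrix.toEuclideanLin P.A (P.s k • (P.W k J - xs))‖ ≤ C := by
  obtain ⟨C, hC0, hC⟩ := hJ.exists_lyapunov_le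
  refine ⟨(1 + 2 * C) + ‖Matrix.toEuclideanLin P.A y‖, by positivity, fun k => ?_⟩
  have h1 := hC k
  rw [lyapunov_eq] at h1
  have h2 := lyapunov_lower_bound h k J
  have h3 := P.weighted_dist_nonneg xs k J
  set v := Matrix.toEuclideanLin P.A (P.s k • (P.W k J - xs))
  set a := Matrix.toEuclideanLin P.A y
  have h4 : ‖a + v‖ ^ 2 ≤ 2 * C := by linarith
  have h5 : ‖a + v‖ ≤ 1 + 2 * C := by nlinarith [sq_nonneg (‖a + v‖ - 1)]
  have h6 : ‖v‖ ≤ ‖a + v‖ + ‖a‖ := by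
    have := norm_sub_le (a + v) a
    rwa [add_sub_cancel_left] at this
  linarith

include hJ h in
-- The upper bound comes from the surrogate inside the Lyapunov function, the lower one from the
-- saddle inequality and the residual bound.
theorem IsRegular.exists_obj_le :
    ∃ C, 0 ≤ C ∧ ∀ k, P.s k * |realObj P.φ P.r (P.W k J) - realObj P.φ P.r xs| ≤ C := by
  obtain ⟨C, hC0, hC⟩ := hJ.exists_lyapunov_le
  obtain ⟨C', hC'0, hC'⟩ := hJ.exists_residual_le h
  refine ⟨C + ‖Matrix.toEuclideanLin P.A y‖ * C', by positivity, fun k => ?_⟩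
  have h1 := hC k
  rw [Setup.lyapunov] at h1
  have h3 := P.weighted_dist_nonneg xs k J
  have h4 := P.s_mul_realObj_W_le k J
  have h2 := mul_le_mul_of_nonneg_left (h.saddle _ (P.W_dom k J)) (P.s_nonneg k)
  have h5 : -(‖Matrix.toEuclideanLin P.A y‖ * C') ≤ P.s k * inner ℝ (Matrix.toEuclideanLin P.A y)
      (Matrix.toEuclideanLin P.A (P.W k J - xs)) := by
    rw [← inner_smul_right, ← map_smul]
    have h6 := (abs_le.1 (abs_real_inner_le_norm (Matrix.toEuclideanLin P.A y)
      (Matrix.toEuclideanLin P.A (P.s k • (P.W k J - xs))))).1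
    have h7 := mul_le_mul_of_nonneg_left (hC' k) (norm_nonneg (Matrix.toEuclideanLin P.A y))
    linarith
  have h8 : 0 ≤ 1 / 2 * ‖Matrix.toEuclideanLin P.A (P.s k • (P.W k J - xs))‖ ^ 2 := by positivity
  have h9 : 0 ≤ 1 / 2 * ‖Matrix.toEuclideanLin P.A y‖ ^ 2 := by positivity
  have h10 : 0 ≤ ‖Matrix.toEuclideanLin P.A y‖ * C' := by positivity
  rw [← abs_of_nonneg (P.s_nonneg k), ← abs_mul, abs_le]
  constructor <;> linarith

include hJ h in
theorem IsRegular.exists_norm_X_le : ∃ C, ∀ k, ‖P.X k J‖ ≤ C := by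
  obtain ⟨C, hC0, hC⟩ := hJ.exists_lyapunov_le
  have hblock : ∀ i, ∃ D, ∀ k, ‖block xs i - block (P.X k J) i‖ ^ 2 ≤ D := by
    intro i
    obtain ⟨c, hc, hcB⟩ := exists_le_sqNorm (P.hB i)
    have hp := P.p_pos i
    have hσ := P.σ_pos
    refine ⟨2 * C * P.p i ^ 2 / (P.σ * c), fun k => ?_⟩
    have h1 := hC k
    rw [lyapunov_eq] at h1
    have h2 := lyapunov_lower_bound h k J
    have h3 : 1 / P.p i ^ 2 * sqNorm (P.B i) (block xs i - block (P.X k J) i) ≤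
        ∑ i, 1 / P.p i ^ 2 * sqNorm (P.B i) (block xs i - block (P.X k J) i) :=
      Finset.single_le_sum (f := fun i => 1 / P.p i ^ 2 *
        sqNorm (P.B i) (block xs i - block (P.X k J) i)) (fun j _ => mul_nonneg (by positivity)
          (sqNorm_nonneg (P.hB j) _)) (Finset.mem_univ i)
    have h4 := hcB (block xs i - block (P.X k J) i)
    have h5 : 0 ≤ 1 / 2 * ‖Matrix.toEuclideanLin P.A y +
        Matrix.toEuclideanLin P.A (P.s k • (P.W k J - xs))‖ ^ 2 := by positivity
    have h6 : P.σ / 2 * (1 / P.p i ^ 2 * (c * ‖block xs i - block (P.X k J) i‖ ^ 2)) ≤ C := by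
      calc _ ≤ P.σ / 2 * (1 / P.p i ^ 2 * sqNorm (P.B i) (block xs i - block (P.X k J) i)) := by
            gcongr
        _ ≤ P.σ / 2 * ∑ i, 1 / P.p i ^ 2 * sqNorm (P.B i) (block xs i - block (P.X k J) i) := by
            gcongr
        _ ≤ C := by linarith
    rw [le_div_iff₀ (by positivity)]
    have h7 : ‖block xs i - block (P.X k J) i‖ ^ 2 * (P.σ * c) = 2 * P.p i ^ 2 *
        (P.σ / 2 * (1 / P.p i ^ 2 * (c * ‖block xs i - block (P.X k J) i‖ ^ 2))) := by
      field_simp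
    rw [h7]
    nlinarith [mul_le_mul_of_nonneg_left h6 (by positivity : 0 ≤ 2 * P.p i ^ 2)]
  choose D hD using hblock
  refine ⟨‖xs‖ + (1 + ∑ i, D i), fun k => ?_⟩
  have h1 : ‖xs - P.X k J‖ ^ 2 ≤ ∑ i, D i := by
    rw [norm_sq_eq_sum_block]
    exact Finset.sum_le_sum fun i _ => hD i k
  have h2 : ‖xs - P.X k J‖ ≤ 1 + ∑ i, D i := by nlinarith [sq_nonneg (‖xs - P.X k J‖ - 1)]
  have h3 := norm_sub_le xs (xs - P.X k J)
  rw [sub_sub_cancel] at h3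
  linarith

include hJ in
theorem IsRegular.tendsto_residual_X :
    Tendsto (fun k => Matrix.toEuclideanLin P.A (P.X k J - xs)) atTop (𝓝 0) := by
  have hσ := P.σ_pos
  have h0 := hJ.decrease.tendsto_atTop_zero
  have h1 : Tendsto (fun k => ‖Matrix.toEuclideanLin P.A (P.X k J - xs)‖ ^ 2) atTop (𝓝 0) := by
    refine squeeze_zero (fun k => by positivity) (fun k => ?_)
      (by simpa using h0.const_mul (2 / P.σ ^ 2))
    have h2 := P.slack_nonneg k J
    have h3 := P.refGap_nonneg xs k J
    have h4 : P.σ ^ 2 / 2 * ‖Matrix.toEuclideanLin P.A (P.X k J - xs)‖ ^ 2 ≤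
        P.decrease xs k J := by
      rw [Setup.decrease]
      nlinarith [mul_nonneg hσ.le h2, mul_nonneg hσ.le h3]
    calc _ = 2 / P.σ ^ 2 * (P.σ ^ 2 / 2 * ‖Matrix.toEuclideanLin P.A (P.X k J - xs)‖ ^ 2) := by
          field_simp
      _ ≤ _ := by gcongr
  rw [tendsto_zero_iff_norm_tendsto_zero]
  simpa using h1.sqrt

include hJ in
-- The metric condition is not strict, so no multiple of the squared step need remain in the
-- decrease. `IsConvexSmooth.exists_sq_norm_le` recovers the step from the slack and the Bregman
-- distances at both ends, all of which are summable.
theorem IsRegular.tendsto_step :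
    Tendsto (fun k => P.fullStep k J - P.X k J) atTop (𝓝 0) := by
  have hσ := P.σ_pos
  have h0 := hJ.decrease.tendsto_atTop_zero
  have h0' := hJ.fullGap.tendsto_atTop_zero
  have hblock : ∀ i, Tendsto (fun k => ‖block (P.fullStep k J - P.X k J) i‖ ^ 2) atTop (𝓝 0) := by
    intro i
    obtain ⟨C, hC, hle⟩ := (P.hφ i).exists_sq_norm_le (P.hL i)
    have hp := P.p_pos i
    have hbound : ∀ k, ‖block (P.fullStep k J - P.X k J) i‖ ^ 2 ≤
        C * (1 / P.σ * P.decrease xs k J + 1 / (P.σ * P.p i) * P.fullGap xs k J) := by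
      intro k
      rw [block_sub]
      refine (hle _ _ (block xs i)).trans ?_
      refine mul_le_mul_of_nonneg_left (add_le_add ?_ ?_) hC.le
      · have h1 := Finset.single_le_sum (f := fun i =>
          1 / 2 * sqNorm (P.L i) (block (P.fullStep k J) i - block (P.X k J) i) -
            bregman (P.φ i) (block (P.fullStep k J) i) (block (P.X k J) i))
          (fun j _ => sub_nonneg.2 ((P.hφ j).bregman_le _ _)) (Finset.mem_univ i)
        have h2 := Finset.single_le_sum (f := fun i =>
          bregman (P.φ i) (block xs i) (block (P.X k J) i))
          (fun j _ => (P.hφ j).bregman_nonneg _ _) (Finset.mem_univ i)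
        have h3 : P.σ * (P.slack k J + P.refGap xs k J) ≤ P.decrease xs k J := by
          rw [Setup.decrease]
          have : 0 ≤ P.σ ^ 2 / 2 * ‖Matrix.toEuclideanLin P.A (P.X k J - xs)‖ ^ 2 := by positivity
          linarith
        have h4 : P.slack k J + P.refGap xs k J ≤ 1 / P.σ * P.decrease xs k J := by
          rw [one_div, inv_mul_eq_div, le_div_iff₀ hσ]
          linarith
        exact (add_le_add h1 h2).trans h4
      · have h1 := Finset.single_le_sum (f := fun i =>
          P.p i * bregman (P.φ i) (block xs i) (block (P.fullStep k J) i))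
          (fun j _ => mul_nonneg (P.p_pos j).le ((P.hφ j).bregman_nonneg _ _)) (Finset.mem_univ i)
        rw [one_div, inv_mul_eq_div, le_div_iff₀ (by positivity), Setup.fullGap]
        have := mul_le_mul_of_nonneg_left h1 hσ.le
        linarith
    have hlim := ((h0.const_mul (1 / P.σ)).add (h0'.const_mul (1 / (P.σ * P.p i)))).const_mul C
    simp only [mul_zero, add_zero] at hlim
    exact squeeze_zero (fun k => by positivity) hbound hlim
  have hsum : Tendsto (fun k => ‖P.fullStep k J - P.X k J‖ ^ 2) atTop (𝓝 0) := by
    simp only [norm_sq_eq_sum_block]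
    simpa using tendsto_finsetSum Finset.univ fun i _ => hblock i
  rw [tendsto_zero_iff_norm_tendsto_zero]
  simpa using hsum.sqrt

include hJ h in
/-- Every cluster point of `x^k` is a solution. -/
theorem IsRegular.mem_solutions_of_tendsto {n : ℕ → ℕ} (hn : Tendsto n atTop atTop)
    {c : BlockVec m} (hc : Tendsto (fun k => P.X (n k) J) atTop (𝓝 c)) :
    c ∈ solutions P.φ P.r P.A P.b := by
  have hAcont : Continuous (Matrix.toEuclideanLin P.A) :=
    LinearMap.continuous_of_finiteDimensional _
  have hstep := hJ.tendsto_step.comp hn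
  have hfull : Tendsto (fun k => P.fullStep (n k) J) atTop (𝓝 c) := by
    have := hstep.add hc
    simpa using this
  have hAc : Matrix.toEuclideanLin P.A (c - xs) = 0 :=
    tendsto_nhds_unique ((hAcont.tendsto _).comp (hc.sub_const xs)) (hJ.tendsto_residual_X.comp hn)
  refine h.mem_solutions_of_le P.hr (by rwa [map_sub, sub_eq_zero] at hAc) ?_
  obtain ⟨C, hC0, hC⟩ := hJ.exists_residual_le h
  obtain ⟨C', hC'⟩ := hJ.tendsto_residual_X.norm.bddAbove_range
  have hdual : ∀ k, ‖P.dualVar xs k J‖ ≤ C + P.σ * C' := by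
    intro k
    rw [dualVar, map_add, map_smul _ P.σ]
    refine (norm_add_le _ _).trans (add_le_add (hC k) ?_)
    rw [norm_smul, Real.norm_of_nonneg P.σ_pos.le]
    exact mul_le_mul_of_nonneg_left (hC' ⟨k, rfl⟩) P.σ_pos.le
  -- The error in the full-step inequality: A(x̂ - x*) against the bounded dual variable, the step
  -- measured in L, and a difference of distances at two points with the same limit.
  set ε : ℕ → ℝ := fun k =>
    (C + P.σ * C') * ‖Matrix.toEuclideanLin P.A (P.fullStep (n k) J - xs)‖ +
    ∑ i, 1 / 2 * sqNorm (P.L i) (block (P.fullStep (n k) J - P.X (n k) J) i) +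
    1 / 2 * ∑ i, 1 / P.p i * (sqNorm (P.B i) (block xs i - block (P.X (n k) J) i) -
      sqNorm (P.B i) (block xs i - block (P.fullStep (n k) J) i)) with hε
  have hle : ∀ k, realObj P.φ P.r (P.fullStep (n k) J) ≤ realObj P.φ P.r xs + ε k := by
    intro k
    have h1 := fullStep_inequality h (n k) J
    have h2 : -((C + P.σ * C') * ‖Matrix.toEuclideanLin P.A (P.fullStep (n k) J - xs)‖) ≤
        inner ℝ (P.dualVar xs (n k) J)
          (Matrix.toEuclideanLin P.A (P.fullStep (n k) J - xs)) := by
      refine le_trans (neg_le_neg ?_) (abs_le.1 (abs_real_inner_le_norm _ _)).1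
      gcongr
      exact hdual _
    have h3 := P.refGap_nonneg xs (n k) J
    have h4 := P.slack_nonneg (n k) J
    rw [refGap] at h3
    rw [slack, Finset.sum_sub_distrib] at h4
    have h5 : 0 ≤ ∑ i, 1 / P.p i * sqNorm (P.B i)
        (block (P.fullStep (n k) J) i - block (P.X (n k) J) i) :=
      Finset.sum_nonneg fun i _ => mul_nonneg (by have := P.p_pos i; positivity)
        (sqNorm_nonneg (P.hB i) _)
    simp only [hε, block_sub]
    simp only [mul_sub, Finset.sum_sub_distrib] at h1 ⊢
    linarith
  have hεlim : Tendsto ε atTop (𝓝 0) := by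
    have e1 : Tendsto (fun k => (C + P.σ * C') *
        ‖Matrix.toEuclideanLin P.A (P.fullStep (n k) J - xs)‖) atTop (𝓝 0) := by
      have := (((hAcont.tendsto _).comp (hfull.sub_const xs)).norm).const_mul (C + P.σ * C')
      rw [hAc] at this
      simpa using this
    have e2 : Tendsto (fun k => ∑ i, 1 / 2 *
        sqNorm (P.L i) (block (P.fullStep (n k) J - P.X (n k) J) i)) atTop (𝓝 0) := by
      have : ∀ i, Tendsto (fun k => 1 / 2 *
          sqNorm (P.L i) (block (P.fullStep (n k) J - P.X (n k) J) i)) atTop (𝓝 0) := by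
        intro i
        have := (((continuous_sqNorm (Q := P.L i)).comp (continuous_block i)).tendsto
          (0 : BlockVec m)).comp hstep
        have h0 : block (0 : BlockVec m) i = 0 := rfl
        simp only [Function.comp_def, h0, sqNorm_zero] at this
        simpa only [mul_zero] using this.const_mul (1 / 2)
      simpa only [Finset.sum_const_zero] using tendsto_finsetSum Finset.univ fun i _ => this i
    have e3 : Tendsto (fun k => 1 / 2 * ∑ i, 1 / P.p i *
        (sqNorm (P.B i) (block xs i - block (P.X (n k) J) i) -
          sqNorm (P.B i) (block xs i - block (P.fullStep (n k) J) i))) atTop (𝓝 0) := by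
      have : ∀ i, Tendsto (fun k => 1 / P.p i *
          (sqNorm (P.B i) (block xs i - block (P.X (n k) J) i) -
            sqNorm (P.B i) (block xs i - block (P.fullStep (n k) J) i))) atTop (𝓝 0) := by
        intro i
        have hcont : Continuous fun v : BlockVec m => sqNorm (P.B i) (block xs i - block v i) :=
          continuous_sqNorm.comp (continuous_const.sub (continuous_block i))
        have := (((hcont.tendsto c).comp hc).sub ((hcont.tendsto c).comp hfull)).const_mul
          (1 / P.p i)
        simpa only [sub_self, mul_zero, Function.comp_def] using this
      simpa only [Finset.sum_const_zero, mul_zero] using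
        (tendsto_finsetSum Finset.univ fun i _ => this i).const_mul (1 / 2)
    simpa only [add_zero] using (e1.add e2).add e3
  -- A real `t` strictly between Ψ(x*) and Ψ(c) is eventually exceeded by Ψ at the full steps, by
  -- lower semicontinuity; the bound Ψ(x*) + ε_k forbids this.
  by_contra hlt
  rw [not_le] at hlt
  obtain ⟨t, ht1, ht2⟩ := EReal.lt_iff_exists_real_btwn.1 hlt
  have hev := hfull.eventually (lowerSemicontinuous_Psi P.hφ P.hr c t ht2)
  have hcontra : t ≤ realObj P.φ P.r xs := by
    refine ge_of_tendsto (by simpa using hεlim.const_add (realObj P.φ P.r xs)) ?_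
    filter_upwards [hev] with k hk
    rw [Psi_eq_realObj P.hr (P.fullStep_dom _ _)] at hk
    exact (EReal.coe_lt_coe_iff.1 hk).le.trans (hle k)
  exact absurd (EReal.coe_lt_coe_iff.1 ht1) (not_lt.2 hcontra)

end Pathwise

/-! ### Uniqueness of the cluster point, and convergence of the averages. -/

/-- The squared weighted distance in the Lyapunov function. -/
def weightedDist (P : Setup m q) (u v : BlockVec m) : ℝ :=
  ∑ i, 1 / P.p i ^ 2 * sqNorm (P.B i) (block u i - block v i)

theorem continuous_weightedDist_left (P : Setup m q) (v : BlockVec m) :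
    Continuous fun u => P.weightedDist u v :=
  continuous_finsetSum _ fun i _ => continuous_const.mul
    (continuous_sqNorm.comp ((continuous_block i).sub continuous_const))

theorem continuous_weightedDist_right (P : Setup m q) (u : BlockVec m) :
    Continuous fun v => P.weightedDist u v :=
  continuous_finsetSum _ fun i _ => continuous_const.mul
    (continuous_sqNorm.comp (continuous_const.sub (continuous_block i)))

theorem weightedDist_self (P : Setup m q) (u : BlockVec m) : P.weightedDist u u = 0 := by
  simp [weightedDist, sqNorm_zero]

theorem eq_of_weightedDist_nonpos (P : Setup m q) {u v : BlockVec m}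
    (h : P.weightedDist u v ≤ 0) : u = v := by
  refine block_ext fun i => ?_
  by_contra hne
  have hp := P.p_pos i
  have h1 := sqNorm_pos (P.hB i) (sub_ne_zero.2 hne)
  have h2 := Finset.single_le_sum (f := fun i =>
    1 / P.p i ^ 2 * sqNorm (P.B i) (block u i - block v i))
    (fun j _ => mul_nonneg (by positivity) (sqNorm_nonneg (P.hB j) _)) (Finset.mem_univ i)
  have h3 : 0 < 1 / P.p i ^ 2 * sqNorm (P.B i) (block u i - block v i) := by positivity
  unfold weightedDist at h
  linarith

theorem weightedDist_nonneg (P : Setup m q) (u v : BlockVec m) : 0 ≤ P.weightedDist u v :=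
  Finset.sum_nonneg fun i _ => mul_nonneg (by positivity) (sqNorm_nonneg (P.hB i) _)

/-- The other terms depend on the solution only through its image under `A` and its value of Ψ,
common to all solutions. Distances need not be known to converge individually; their differences do.
-/
theorem lyapunov_sub_lyapunov {xs' : BlockVec m} (h : IsReference P.φ P.r P.A P.b y xs)
    (h' : IsReference P.φ P.r P.A P.b y xs') (k : ℕ) (J : ℕ → Finset (Fin d)) :
    P.lyapunov y xs k J - P.lyapunov y xs' k J =
      P.σ / 2 * (P.weightedDist xs (P.X k J) - P.weightedDist xs' (P.X k J)) := by
  have hA : Matrix.toEuclideanLin P.A xs = Matrix.toEuclideanLin P.A xs' :=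
    (mem_feasible_iff_of_normal h'.normal).1 (mem_feasible_of_normal h.normal)
  have h1 := h.saddle _ h'.dom
  have h2 := h'.saddle _ h.dom
  rw [map_sub, hA, sub_self, inner_zero_right, add_zero] at h1 h2
  have hobj : realObj P.φ P.r xs = realObj P.φ P.r xs' := le_antisymm h1 h2
  simp only [lyapunov, weightedDist, map_smul, map_sub, hA, hobj]
  ring

/-- The iterates `x^k` converge to a solution along a realisation that is regular for a dense set
of solutions. -/
theorem exists_tendsto_X {J : ℕ → Finset (Fin d)} {D : Set (BlockVec m)}
    (hne : (solutions P.φ P.r P.A P.b).Nonempty)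
    (hDs : solutions P.φ P.r P.A P.b ⊆ closure D)
    (hD : ∀ u ∈ D, IsReference P.φ P.r P.A P.b y u) (hJ : ∀ u ∈ D, P.IsRegular y u J) :
    ∃ c ∈ solutions P.φ P.r P.A P.b, Tendsto (fun k => P.X k J) atTop (𝓝 c) := by
  obtain ⟨u, hu⟩ : D.Nonempty := by
    obtain ⟨v, hv⟩ := hne
    exact closure_nonempty_iff.1 ⟨v, hDs hv⟩
  obtain ⟨C, hC⟩ := (hJ u hu).exists_norm_X_le (hD u hu)
  have hmem : ∀ k, P.X k J ∈ Metric.closedBall (0 : BlockVec m) C := fun k => by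
    simpa using hC k
  have hcluster : ∀ c, MapClusterPt c atTop (fun k => P.X k J) →
      ∃ n : ℕ → ℕ, Tendsto n atTop atTop ∧ Tendsto (fun k => P.X (n k) J) atTop (𝓝 c) := by
    intro c hc
    obtain ⟨n, hn, hlim⟩ := hc.tendsto_subseq
    exact ⟨n, hn.tendsto_atTop, hlim⟩
  have hunique : ∀ c₁ c₂, MapClusterPt c₁ atTop (fun k => P.X k J) →
      MapClusterPt c₂ atTop (fun k => P.X k J) → c₁ = c₂ := by
    intro c₁ c₂ hc₁ hc₂
    obtain ⟨n₁, hn₁, hl₁⟩ := hcluster c₁ hc₁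
    obtain ⟨n₂, hn₂, hl₂⟩ := hcluster c₂ hc₂
    have hs₁ := (hJ u hu).mem_solutions_of_tendsto (hD u hu) hn₁ hl₁
    have hs₂ := (hJ u hu).mem_solutions_of_tendsto (hD u hu) hn₂ hl₂
    have hcont : ∀ c, Continuous fun z : BlockVec m × BlockVec m =>
        P.weightedDist z.1 c - P.weightedDist z.2 c := fun c =>
      ((P.continuous_weightedDist_left c).comp continuous_fst).sub
        ((P.continuous_weightedDist_left c).comp continuous_snd)
    have hclosed : IsClosed {z : BlockVec m × BlockVec m |
        P.weightedDist z.1 c₁ - P.weightedDist z.2 c₁ =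
          P.weightedDist z.1 c₂ - P.weightedDist z.2 c₂} :=
      isClosed_eq (hcont c₁) (hcont c₂)
    have hsub : D ×ˢ D ⊆ {z : BlockVec m × BlockVec m |
        P.weightedDist z.1 c₁ - P.weightedDist z.2 c₁ =
          P.weightedDist z.1 c₂ - P.weightedDist z.2 c₂} := by
      rintro ⟨v, v'⟩ ⟨hv, hv'⟩
      obtain ⟨l, hl⟩ := (hJ v hv).lyapunov
      obtain ⟨l', hl'⟩ := (hJ v' hv').lyapunov
      have hdiff := hl.sub hl'
      simp only [lyapunov_sub_lyapunov (hD v hv) (hD v' hv')] at hdiff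
      have hlim : ∀ c (n : ℕ → ℕ), Tendsto n atTop atTop →
          Tendsto (fun k => P.X (n k) J) atTop (𝓝 c) →
          P.σ / 2 * (P.weightedDist v c - P.weightedDist v' c) = l - l' := by
        intro c n hn hc
        refine tendsto_nhds_unique ?_ (hdiff.comp hn)
        have hcont' : Continuous fun x => P.σ / 2 * (P.weightedDist v x - P.weightedDist v' x) :=
          continuous_const.mul
            ((P.continuous_weightedDist_right v).sub (P.continuous_weightedDist_right v'))
        exact (hcont'.tendsto c).comp hc
      have e := (hlim c₁ n₁ hn₁ hl₁).trans (hlim c₂ n₂ hn₂ hl₂).symm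
      exact mul_left_cancel₀ (by have := P.σ_pos; positivity) e
    -- The identity extends from the dense set to (c₁, c₂), where it reads -dist(c₂, c₁) = dist(c₁,
    -- c₂) for the weighted distance, so both vanish.
    have hmem₁₂ : (c₁, c₂) ∈ closure (D ×ˢ D) := by
      rw [closure_prod_eq]
      exact ⟨hDs hs₁, hDs hs₂⟩
    have heq := Set.mem_ofPred_eq.mp (closure_minimal hsub hclosed hmem₁₂)
    rw [weightedDist_self, weightedDist_self] at heq
    exact P.eq_of_weightedDist_nonpos (by linarith [P.weightedDist_nonneg c₂ c₁])
  obtain ⟨c, -, hc⟩ := (isCompact_closedBall (0 : BlockVec m) C).exists_mapClusterPt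
    (f := atTop) (u := fun k => P.X k J) (by
      rw [le_principal_iff]; exact Filter.mem_map.2 (Eventually.of_forall hmem))
  refine ⟨c, ?_, (isCompact_closedBall (0 : BlockVec m) C).tendsto_nhds_of_unique_mapClusterPt
    (Eventually.of_forall hmem) fun c' _ hc' => hunique c' c hc' hc⟩
  obtain ⟨n, hn, hl⟩ := hcluster c hc
  exact (hJ u hu).mem_solutions_of_tendsto (hD u hu) hn hl

theorem s_smul_W (P : Setup m q) (k : ℕ) (J : ℕ → Finset (Fin d)) :
    P.s k • P.W k J = P.σ • ∑ j ∈ Finset.range k, P.X j J +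
      (P.σ • Matrix.toEuclideanLin (weightMat m P.p) (P.X k J - P.x0) +
        (1 - P.σ) • P.x0) := by
  refine block_ext fun i => ?_
  simp only [block_smul, block_add, block_sum, block_weightMat, block_sub]
  rw [s_smul_block_W]
  module

theorem tendsto_s_div (P : Setup m q) :
    Tendsto (fun k : ℕ => P.s k / k) atTop (𝓝 P.σ) := by
  have h : Tendsto (fun k : ℕ => (1 - P.σ) / (k : ℝ) + P.σ) atTop (𝓝 (0 + P.σ)) :=
    (tendsto_const_div_atTop_nhds_zero_nat _).add_const _
  rw [zero_add] at h
  refine h.congr' ?_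
  filter_upwards [eventually_gt_atTop 0] with k hk
  have : (k : ℝ) ≠ 0 := by exact_mod_cast hk.ne'
  unfold s
  field_simp

/-- The iterates `w^k` have the same limit as `x^k`. -/
theorem tendsto_W {J : ℕ → Finset (Fin d)} {c : BlockVec m}
    (hc : Tendsto (fun k => P.X k J) atTop (𝓝 c)) :
    Tendsto (fun k => P.W k J) atTop (𝓝 c) := by
  have hPcont : Continuous (Matrix.toEuclideanLin (weightMat m P.p)) :=
    LinearMap.continuous_of_finiteDimensional _
  have hrem : Tendsto (fun k => P.σ • Matrix.toEuclideanLin (weightMat m P.p) (P.X k J - P.x0) +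
      (1 - P.σ) • P.x0) atTop
      (𝓝 (P.σ • Matrix.toEuclideanLin (weightMat m P.p) (c - P.x0) + (1 - P.σ) • P.x0)) :=
    (((hPcont.tendsto _).comp (hc.sub_const P.x0)).const_smul P.σ).add_const _
  have hinv : Tendsto (fun k : ℕ => ((k : ℝ))⁻¹) atTop (𝓝 0) := tendsto_inv_atTop_nhds_zero_nat
  -- Divided by k, s_k w^k is σ times a Cesàro mean of the x^j plus a convergent remainder over k,
  -- while s_k/k → σ.
  have hnum := (hc.cesaro_smul.const_smul P.σ).add (hinv.smul hrem)
  have hq := (P.tendsto_s_div.inv₀ P.σ_pos.ne').smul hnum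
  rw [zero_smul, add_zero, smul_smul, inv_mul_cancel₀ P.σ_pos.ne', one_smul] at hq
  refine hq.congr' ?_
  filter_upwards [eventually_gt_atTop 0] with k hk
  have hk' : (k : ℝ) ≠ 0 := by exact_mod_cast hk.ne'
  obtain ⟨l, rfl⟩ : ∃ l, k = l + 1 := ⟨k - 1, by omega⟩
  have hs := (P.s_succ_pos l).ne'
  rw [smul_comm P.σ, ← smul_add, ← s_smul_W, smul_smul, smul_smul, mul_assoc]
  have : (P.s (l + 1) / ((l + 1 : ℕ) : ℝ))⁻¹ * ((((l + 1 : ℕ) : ℝ))⁻¹ * P.s (l + 1)) = 1 := by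
    field_simp
  rw [this, one_smul]

theorem isBigO_one_div_of_s_mul_le {f : ℕ → ℝ} {C : ℝ} (P : Setup m q)
    (hf : ∀ k, P.s k * |f k| ≤ C) : f =O[atTop] fun k : ℕ => 1 / (k : ℝ) := by
  have hσ := P.σ_pos
  have hev : ∀ᶠ k : ℕ in atTop, P.σ / 2 < P.s k / k :=
    P.tendsto_s_div.eventually (lt_mem_nhds (by linarith))
  refine IsBigO.of_bound (2 * C / P.σ) ?_
  filter_upwards [hev, eventually_gt_atTop 0] with k hk hk0
  have hk' : (0 : ℝ) < k := by exact_mod_cast hk0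
  rw [Real.norm_eq_abs, Real.norm_of_nonneg (by positivity)]
  rw [lt_div_iff₀ hk'] at hk
  have h1 : P.σ / 2 * k * |f k| ≤ C := le_trans (by gcongr) (hf k)
  rw [div_mul_div_comm, mul_one, le_div_iff₀ (by positivity)]
  linarith

end Setup

theorem Psi_ne_top_and_ne_bot {d : ℕ} {m : Fin d → ℕ}
    {φ : (i : Fin d) → EuclideanSpace ℝ (Fin (m i)) → ℝ}
    {r : (i : Fin d) → EuclideanSpace ℝ (Fin (m i)) → EReal}
    (hr : ∀ i, IsProperConvexLsc (r i)) {x : BlockVec m} (hx : x ∈ objDom r) :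
    Psi φ r x ≠ ⊤ ∧ Psi φ r x ≠ ⊥ := by
  rw [Psi_eq_realObj hr hx]
  exact ⟨EReal.coe_ne_top _, EReal.coe_ne_bot _⟩

/-! ### The rates and the random limit. -/

namespace Setup

variable {d q : ℕ} {m : Fin d → ℕ} {P : Setup m q} {y xs : BlockVec m}
  {Ω : Type*} [MeasurableSpace Ω] {μ : Measure Ω} {ι : ℕ → Ω → Finset (Fin d)}

theorem measurable_X (P : Setup m q) (hι : ∀ k, Measurable (ι k)) (k : ℕ) :
    Measurable fun ω => P.X k fun j => ι j ω := by
  have : (fun ω => P.X k fun j => ι j ω) =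
      (fun g : Fin k → Finset (Fin d) => P.X k (extendPast ∅ g)) ∘ pastOf ι k := by
    funext ω
    exact (P.X_dependsOnPast le_rfl).eq_extendPast ι ∅ ω
  rw [this]
  exact (measurable_of_finite _).comp (measurable_pi_lambda _ fun j => hι j)

theorem IsRegular.isBigO_penalty {J : ℕ → Finset (Fin d)} (hJ : P.IsRegular y xs J)
    (h : IsReference P.φ P.r P.A P.b y xs) :
    (fun k : ℕ => penalty P.A P.b (P.W k J) - penalty P.A P.b xs)
      =O[atTop] fun k : ℕ => 1 / (k : ℝ) ^ 2 := by
  obtain ⟨C, -, hC⟩ := hJ.exists_residual_le h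
  have h1 := P.isBigO_one_div_of_s_mul_le
    (f := fun k => ‖Matrix.toEuclideanLin P.A (P.W k J - xs)‖) (C := C) fun k => by
      have := hC k
      rwa [map_smul, norm_smul, Real.norm_of_nonneg (P.s_nonneg k), ← abs_norm] at this
  simp only [penalty_sub_of_normal h.normal]
  simpa only [div_pow, one_pow] using (h1.pow 2).const_mul_left (1 / 2)

theorem IsRegular.isBigO_obj {J : ℕ → Finset (Fin d)} (hJ : P.IsRegular y xs J)
    (h : IsReference P.φ P.r P.A P.b y xs) :
    (fun k : ℕ => |(Psi P.φ P.r (P.W k J)).toReal - (Psi P.φ P.r xs).toReal|)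
      =O[atTop] fun k : ℕ => 1 / (k : ℝ) := by
  obtain ⟨C, -, hC⟩ := hJ.exists_obj_le h
  simp only [Psi_eq_realObj P.hr (P.W_dom _ J), Psi_eq_realObj P.hr h.dom, EReal.toReal_coe]
  exact P.isBigO_one_div_of_s_mul_le fun k => by rw [abs_abs]; exact hC k

/-- Regularity fails on a null set depending on the solution; a countable dense set of solutions
gives one null set for all that `exists_tendsto_X` requires. -/
theorem exists_ae_limit [IsProbabilityMeasure μ] (hι : ∀ k, Measurable (ι k))
    (hind : iIndepFun ι μ) (hν : ∀ k, μ.map (ι k) = P.ν)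
    (h : IsReference P.φ P.r P.A P.b y xs) :
    ∃ xbar : Ω → BlockVec m, Measurable xbar ∧ (∀ ω, xbar ω ∈ solutions P.φ P.r P.A P.b) ∧
      ∀ᵐ ω ∂μ, Tendsto (fun k => P.X k fun j => ι j ω) atTop (𝓝 (xbar ω)) ∧
        Tendsto (fun k => P.W k fun j => ι j ω) atTop (𝓝 (xbar ω)) := by
  have hxs := h.mem_solutions P.hr
  obtain ⟨D, hDs, hDc, hDd⟩ := (TopologicalSpace.IsSeparable.of_separableSpace
    (solutions P.φ P.r P.A P.b)).exists_countable_dense_subset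
  have href : ∀ u ∈ D, IsReference P.φ P.r P.A P.b y u := fun u hu =>
    h.of_mem_solutions P.hr (hDs hu)
  have hreg : ∀ᵐ ω ∂μ, ∀ u ∈ D, P.IsRegular y u fun j => ι j ω :=
    (ae_ball_iff hDc).2 fun u hu => ae_isRegular hι hind hν (href u hu)
  have hlim : ∀ᵐ ω ∂μ, ∃ c ∈ solutions P.φ P.r P.A P.b,
      Tendsto (fun k => P.X k fun j => ι j ω) atTop (𝓝 c) := by
    filter_upwards [hreg] with ω hω
    exact exists_tendsto_X ⟨xs, hxs⟩ hDd href hω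
  obtain ⟨f, hfm, hf⟩ := measurable_limit_of_tendsto_metrizable_ae
    (fun k => (P.measurable_X hι k).aemeasurable)
    (hlim.mono fun ω hω => hω.imp fun c hc => hc.2)
  have hmem : ∀ᵐ ω ∂μ, f ω ∈ solutions P.φ P.r P.A P.b := by
    filter_upwards [hlim, hf] with ω hω hfω
    obtain ⟨c, hc, hcl⟩ := hω
    rwa [tendsto_nhds_unique hfω hcl]
  classical
  -- A measurable null superset of the bad event. Redefining the limit there as a fixed solution
  -- keeps it measurable and makes it a solution everywhere.
  set N := toMeasurable μ {ω | f ω ∈ solutions P.φ P.r P.A P.b}ᶜ with hN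
  have hN0 : ∀ᵐ ω ∂μ, ω ∉ N := by
    have : μ N = 0 := by rw [hN, measure_toMeasurable]; exact ae_iff.1 hmem
    exact measure_eq_zero_iff_ae_notMem.1 this
  refine ⟨fun ω => if ω ∈ N then xs else f ω,
    Measurable.ite (measurableSet_toMeasurable _ _) measurable_const hfm, fun ω => ?_, ?_⟩
  · by_cases hω : ω ∈ N
    · simpa only [if_pos hω] using hxs
    · simp only [if_neg hω]
      by_contra hcon
      exact hω (subset_toMeasurable _ _ hcon)
  · filter_upwards [hN0, hf] with ω hω hfω
    simp only [if_neg hω]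
    exact ⟨hfω, tendsto_W hfω⟩

end Setup

theorem moment_of_posSemidef {d q : ℕ} {m : Fin d → ℕ} {Ω : Type*} [MeasurableSpace Ω]
    {μ : Measure Ω} [IsProbabilityMeasure μ] {I : Ω → Finset (Fin d)} (hI : Measurable I)
    {A : Matrix (Fin q) ((i : Fin d) × Fin (m i)) ℝ}
    {L B : (i : Fin d) → Matrix (Fin (m i)) (Fin (m i)) ℝ} {σ : ℝ}
    (hMI : (weightMat m (actProb μ I) * Matrix.blockDiagonal' B
      - (σ • Xi μ I A + Matrix.blockDiagonal' L)).PosSemidef) (v : BlockVec m) :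
    σ * ∫ J, ‖Matrix.toEuclideanLin A (Matrix.toEuclideanLin (weightMat m (actProb μ I))
        (Matrix.toEuclideanLin (activation m J) v))‖ ^ 2 ∂(μ.map I) +
      ∑ i, sqNorm (L i) (block v i) ≤ ∑ i, 1 / actProb μ I i * sqNorm (B i) (block v i) := by
  have h := hMI.dotProduct_mulVec_nonneg v.ofLp
  rw [star_trivial, ← inner_toEuclideanLin_eq_dotProduct, map_sub, map_add, map_smul,
    LinearMap.sub_apply, LinearMap.add_apply, LinearMap.smul_apply, inner_sub_left,
    inner_add_left, inner_smul_left, inner_weightMat_mul, inner_blockDiagonal', inner_Xi μ hI] at h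
  simp only [conj_trivial] at h
  linarith

end RBCD

end

theorem theorem1 {d q : ℕ} {m : Fin d → ℕ}
    (φ : (i : Fin d) → EuclideanSpace ℝ (Fin (m i)) → ℝ)
    (r : (i : Fin d) → EuclideanSpace ℝ (Fin (m i)) → EReal)
    (A : Matrix (Fin q) ((i : Fin d) × Fin (m i)) ℝ) (b : EuclideanSpace ℝ (Fin q))
    (L B : (i : Fin d) → Matrix (Fin (m i)) (Fin (m i)) ℝ)
    (hL : ∀ i, (L i).PosDef) (hB : ∀ i, (B i).PosDef)
    (hφ : ∀ i, RBCD.IsConvexSmooth (φ i) (L i))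
    (hr : ∀ i, RBCD.IsProperConvexLsc (r i))
    -- existence of a saddle point, and of a solution
    (hsaddle : ∃ xs ys : RBCD.BlockVec m, RBCD.IsSaddlePoint φ r A b xs ys)
    (hsol : (RBCD.solutions φ r A b).Nonempty)
    -- proper i.i.d. sampling
    {Ω : Type*} [MeasurableSpace Ω] (μ : Measure Ω) [IsProbabilityMeasure μ]
    (I : Ω → Finset (Fin d)) (ι : ℕ → Ω → Finset (Fin d))
    (hι : RBCD.IsIIDSampling μ I ι)
    (hproper : ∀ i, 0 < RBCD.actProb μ I i)
    -- parameters and starting point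
    (σ : ℝ) (hσ : 0 < σ) (hσp : ∀ i, σ ≤ RBCD.actProb μ I i)
    (hMI : (RBCD.weightMat m (RBCD.actProb μ I) * Matrix.blockDiagonal' B
      - (σ • RBCD.Xi μ I A + Matrix.blockDiagonal' L)).PosSemidef)
    (x0 : RBCD.BlockVec m) (hx0 : RBCD.Reg r x0 ≠ ⊤)
    -- the iterates
    (x w : ℕ → Ω → RBCD.BlockVec m)
    (hx : ∀ k ω, x k ω = (RBCD.iterates φ r A b B (RBCD.actProb μ I) (fun _ => σ) (fun _ => 1)
      x0 (fun j => ι j ω) k).1)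
    (hw : ∀ k ω, w k ω = (RBCD.iterates φ r A b B (RBCD.actProb μ I) (fun _ => σ) (fun _ => 1)
      x0 (fun j => ι j ω) k).2) :
    (∀ xs ∈ RBCD.solutions φ r A b, ∀ᵐ ω ∂μ,
      (fun k : ℕ => RBCD.penalty A b (w k ω) - RBCD.penalty A b xs)
        =O[atTop] fun k : ℕ => 1 / (k : ℝ) ^ 2) ∧
    (∃ xbar : Ω → RBCD.BlockVec m, Measurable xbar ∧
      (∀ ω, xbar ω ∈ RBCD.solutions φ r A b) ∧
      ∀ᵐ ω ∂μ, Tendsto (fun k => x k ω) atTop (𝓝 (xbar ω)) ∧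
        Tendsto (fun k => w k ω) atTop (𝓝 (xbar ω))) ∧
    (∀ xs ∈ RBCD.solutions φ r A b, RBCD.Psi φ r xs ≠ ⊤ ∧ RBCD.Psi φ r xs ≠ ⊥ ∧
      ∀ᵐ ω ∂μ, (∀ k, RBCD.Psi φ r (w k ω) ≠ ⊤ ∧ RBCD.Psi φ r (w k ω) ≠ ⊥) ∧
        (fun k : ℕ => |(RBCD.Psi φ r (w k ω)).toReal - (RBCD.Psi φ r xs).toReal|)
          =O[atTop] fun k : ℕ => 1 / (k : ℝ)) := by
  obtain ⟨xs₀, y, hs⟩ := hsaddle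
  have href := hs.isReference hr
  have hfin : ∀ xs ∈ RBCD.solutions φ r A b, RBCD.Psi φ r xs ≠ ⊤ ∧ RBCD.Psi φ r xs ≠ ⊥ :=
    fun xs hxs => RBCD.Psi_ne_top_and_ne_bot hr (href.of_mem_solutions hr hxs).dom
  -- Without blocks nothing bounds σ by one, but the space is a single point. Otherwise σ ≤ π_i ≤ 1
  -- for some block i.
  rcases Nat.eq_zero_or_pos d with rfl | hd
  · have hsub : ∀ u v : RBCD.BlockVec m, u = v := fun u v => RBCD.block_ext fun i => i.elim0
    have hws : ∀ xs k ω, w k ω = xs := fun xs k ω => hsub _ _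
    refine ⟨fun xs _ => ae_of_all _ fun ω => ?_, ⟨fun _ => xs₀, measurable_const,
      fun _ => href.mem_solutions hr, ae_of_all _ fun ω => ⟨?_, ?_⟩⟩,
      fun xs hxs => ⟨(hfin xs hxs).1, (hfin xs hxs).2, ae_of_all _ fun ω => ⟨fun k => ?_, ?_⟩⟩⟩
    · simpa only [hws xs, sub_self] using isBigO_zero _ _
    · exact tendsto_const_nhds.congr fun k => hsub _ _
    · exact tendsto_const_nhds.congr fun k => hsub _ _
    · rw [hws xs]; exact hfin xs hxs
    · simpa only [hws xs, sub_self, abs_zero] using isBigO_zero _ _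
  · have hI := hι.measurable
    have hprob : IsProbabilityMeasure (μ.map I) :=
      Measure.isProbabilityMeasure_map hI.aemeasurable
    let P : RBCD.Setup m q :=
      { φ := φ, r := r, A := A, b := b, L := L, B := B, hL := hL, hB := hB, hφ := hφ, hr := hr
        ν := μ.map I, prob := hprob, p := RBCD.actProb μ I
        p_eq := fun i => by rw [map_measureReal_apply hI MeasurableSet.of_discrete]; rfl
        p_pos := hproper, σ := σ, σ_pos := hσ, σ_le_p := hσp
        σ_le_one := (hσp ⟨0, hd⟩).trans measureReal_le_one
        moment := RBCD.moment_of_posSemidef hI hMI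
        x0 := x0, x0_dom := RBCD.mem_objDom_of_Reg_ne_top hr hx0 }
    have hν : ∀ k, μ.map (ι k) = P.ν := fun k => (hι.ident k).map_eq
    have hxP : ∀ ω, (fun k => x k ω) = fun k => P.X k fun j => ι j ω := fun ω =>
      funext fun k => hx k ω
    have hwP : ∀ k ω, w k ω = P.W k fun j => ι j ω := hw
    have hreg : ∀ xs ∈ RBCD.solutions φ r A b, ∀ᵐ ω ∂μ, P.IsRegular y xs fun j => ι j ω :=
      fun xs hxs => RBCD.Setup.ae_isRegular hι.measurable_copy hι.indep hν
        (href.of_mem_solutions hr hxs)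
    refine ⟨fun xs hxs => ?_, ?_, fun xs hxs => ⟨(hfin xs hxs).1, (hfin xs hxs).2, ?_⟩⟩
    · filter_upwards [hreg xs hxs] with ω hω
      simp only [hwP]
      exact hω.isBigO_penalty (href.of_mem_solutions hr hxs)
    · obtain ⟨xbar, h1, h2, h3⟩ := RBCD.Setup.exists_ae_limit (P := P) hι.measurable_copy hι.indep hν
        href
      refine ⟨xbar, h1, h2, ?_⟩
      simp only [hxP, hwP]
      exact h3
    · filter_upwards [hreg xs hxs] with ω hω
      simp only [hwP]
      exact ⟨fun k => RBCD.Psi_ne_top_and_ne_bot hr (P.W_dom k _),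
        hω.isBigO_obj (href.of_mem_solutions hr hxs)⟩
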